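/- Let $N=3$, $p>5$, $\lambda>0$ and $0<a<b<\infty$. Consider the problem $$(A)\qquad u''+\frac{2}{r}u'+\lambda u+u^p=0\ \ \text{for } r\in(a,b),\qquad u(a)=u(b)=0,$$ where a positive solution is a function $u\in C^2(a,b)\cap C[a,b]$ with $u>0$ on $(a,b)$ that satisfies $(A)$. Put $$r_0=\sqrt{\frac{2((N-2)p+N-4)((N-2)p-(N+2))}{\lambda(p-1)(p+3)^2}}=\sqrt{\frac{2(p-1)(p-5)}{\lambda(p-1)(p+3)^2}}.$$ Assume that one of the following holds: (i) $r_0\le a$ or $b\le r_0$, and in addition $b<a+\frac{\pi}{\sqrt\lambda}$; (ii) $a<r_0<b$ and $$a+\frac{\pi}{\sqrt\lambda}-\frac{1}{\sqrt\lambda}\arctan\left(\frac{2(p+3)\sqrt\lambda}{p-5}\,a\right)\le b<a+\frac{\pi}{\sqrt\lambda};$$ (iii) $a<r_0<b$ and $$b\le -a+\frac{1}{\sqrt\lambda}\left(\frac{2\sqrt{2(p-5)}}{p+3}+\arccos\left(-\sqrt{\frac{p-5}{p+3}}\right)\right).$$ Then problem $(A)$ has exactly one positive solution. -/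

import Mathlib

/-- `u` is a positive solution of the two-point boundary value problem
`u'' + (N - 1) / r * u' + lam * u + u ^ p = 0` on `(a, b)`, `u a = u b = 0`:
a classical solution, in `C²(a, b) ∩ C[a, b]`, with `u > 0` on `(a, b)`.
Values of `u` outside `[a, b]` play no role. -/
structure IsPositiveSolution (N : ℕ) (lam p a b : ℝ) (u : ℝ → ℝ) : Prop where
  continuousOn : ContinuousOn u (Set.Icc a b)
  contDiffOn : ContDiffOn ℝ 2 u (Set.Ioo a b)
  equation : ∀ r ∈ Set.Ioo a b,
    deriv (deriv u) r + ((N : ℝ) - 1) / r * deriv u r + lam * u r + u r ^ p = 0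
  left_boundary : u a = 0
  right_boundary : u b = 0
  pos : ∀ r ∈ Set.Ioo a b, 0 < u r

/-- The boundary value problem has exactly one positive solution, as a function on `[a, b]`. -/
def HasUniquePositiveSolution (N : ℕ) (lam p a b : ℝ) : Prop :=
  ∃ u : ℝ → ℝ, IsPositiveSolution N lam p a b u ∧
    ∀ v : ℝ → ℝ, IsPositiveSolution N lam p a b v → Set.EqOn v u (Set.Icc a b)

/-- The threshold radius
`r₀ = √(2((N-2)p + N - 4)((N-2)p - (N+2)) / (lam (p-1) (p+3)²))`. -/
noncomputable def thresholdRadius (N : ℕ) (lam p : ℝ) : ℝ :=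
  Real.sqrt (2 * (((N : ℝ) - 2) * p + (N : ℝ) - 4) * (((N : ℝ) - 2) * p - ((N : ℝ) + 2)) /
    (lam * (p - 1) * (p + 3) ^ 2))

/-! With k = √λ, the substitution w = ru removes the first-order term and turns (A) into w'' + k²w +
r^(1-p)w^p = 0, w(a) = w(b) = 0. In every case k(b-a) < π, so the linear part w'' + k²w has no
conjugate points on [a, b].

Existence uses only this bound. Shoot from a with slope α: Sturm comparison shows that w(b) > 0 for
small α and w(b) ≤ 0 for large α, and continuity in α gives a zero of w(b)
(`exists_isReducedSolution`).

Uniqueness rests on a Pohozaev functional J with weight c(r) = sin k(r-a) sin k(b-r). Here J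
vanishes at a and b, and J' is a positive multiple of r^(-p) w^(p+1) N, where N = rc' - (q+1)c and q
= (p-5)/(p+3). Suppose N changes sign once, from plus to minus. Then J ≥ 0. If w₁, w₂ are solutions
with w₂'(a) < w₁'(a), the ratio w₂/w₁ increases up to the first zero s of their Wronskian, and a
suitable combination σJ₁ - J₂ is positive at s by its monotonicity but nonpositive there by direct
evaluation (`not_slope_lt`). So the slopes at a agree, and Gronwall's inequality finishes.

The single sign change of N comes from D = r^(q-1)N', the Wronskian of c' and r^q. Both functions
solve simple second-order equations, so on the left half of [a, b] D increases up to the radius r₀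
and decreases after it. As D ≤ 0 at the midpoint, only D(a) < 0 < D(r₀) with a < r₀ < (a+b)/2 can
spoil the sign pattern; the three cases exclude this (`exists_pohozaevSign_change`). -/

open Set

/-! ### Monotonicity and concavity from derivatives in the interior -/

/-- A continuous function on `[a, b]` with nonnegative derivative inside is monotone. -/
theorem monotoneOn_Icc_of_hasDerivAt {a b : ℝ} {f f' : ℝ → ℝ} (hc : ContinuousOn f (Icc a b))
    (hd : ∀ x ∈ Ioo a b, HasDerivAt f (f' x) x) (h : ∀ x ∈ Ioo a b, 0 ≤ f' x) :
    MonotoneOn f (Icc a b) := by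
  refine monotoneOn_of_hasDerivWithinAt_nonneg (f' := f') (convex_Icc a b) hc ?_ ?_ <;>
    rw [interior_Icc]
  exacts [fun x hx => (hd x hx).hasDerivWithinAt, h]

theorem antitoneOn_Icc_of_hasDerivAt {a b : ℝ} {f f' : ℝ → ℝ} (hc : ContinuousOn f (Icc a b))
    (hd : ∀ x ∈ Ioo a b, HasDerivAt f (f' x) x) (h : ∀ x ∈ Ioo a b, f' x ≤ 0) :
    AntitoneOn f (Icc a b) := by
  refine antitoneOn_of_hasDerivWithinAt_nonpos (f' := f') (convex_Icc a b) hc ?_ ?_ <;>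
    rw [interior_Icc]
  exacts [fun x hx => (hd x hx).hasDerivWithinAt, h]

theorem strictMonoOn_Icc_of_hasDerivAt {a b : ℝ} {f f' : ℝ → ℝ} (hc : ContinuousOn f (Icc a b))
    (hd : ∀ x ∈ Ioo a b, HasDerivAt f (f' x) x) (h : ∀ x ∈ Ioo a b, 0 < f' x) :
    StrictMonoOn f (Icc a b) := by
  refine strictMonoOn_of_hasDerivWithinAt_pos (f' := f') (convex_Icc a b) hc ?_ ?_ <;>
    rw [interior_Icc]
  exacts [fun x hx => (hd x hx).hasDerivWithinAt, h]

theorem concaveOn_Icc_of_hasDerivAt {a b : ℝ} {f f' f'' : ℝ → ℝ} (hc : ContinuousOn f (Icc a b))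
    (hd : ∀ x ∈ Ioo a b, HasDerivAt f (f' x) x) (hd' : ∀ x ∈ Ioo a b, HasDerivAt f' (f'' x) x)
    (h : ∀ x ∈ Ioo a b, f'' x ≤ 0) : ConcaveOn ℝ (Icc a b) f := by
  refine concaveOn_of_hasDerivWithinAt2_nonpos (f' := f') (f'' := f'') (convex_Icc a b) hc ?_ ?_ ?_
    <;> rw [interior_Icc]
  exacts [fun x hx => (hd x hx).hasDerivWithinAt, fun x hx => (hd' x hx).hasDerivWithinAt, h]

/-- A function that is continuous at the left end of `[a, b]` and positive there is positive
on an initial segment. -/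
theorem exists_forall_pos_of_continuousOn {a b : ℝ} (hab : a < b) {f : ℝ → ℝ}
    (hc : ContinuousOn f (Icc a b)) (h : 0 < f a) :
    ∃ x ∈ Ioo a b, ∀ r ∈ Icc a x, 0 < f r := by
  have h1 : ∀ᶠ r in nhdsWithin a (Icc a b), 0 < f r :=
    (hc a (left_mem_Icc.2 hab.le)).eventually (lt_mem_nhds h)
  rw [nhdsWithin_Icc_eq_nhdsGE hab] at h1
  obtain ⟨x, hx, hsub⟩ := (mem_nhdsGE_iff_exists_mem_Ioc_Ico_subset hab).1 h1
  refine ⟨(a + x) / 2, ⟨by linarith [hx.1], by linarith [hx.1, hx.2]⟩, fun r hr => hsub ⟨hr.1, ?_⟩⟩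
  linarith [hr.2, hx.1]

/-! ### The weight and the single sign change of `pohozaevSign` -/

/-- The weight `sin k(r-a) sin k(b-r)`. -/
noncomputable def sineWeight (k a b r : ℝ) : ℝ := Real.sin (k * (r - a)) * Real.sin (k * (b - r))

/-- The derivative of `sineWeight`. -/
noncomputable def sineWeightDeriv (k a b r : ℝ) : ℝ := k * Real.sin (k * (a + b - 2 * r))

theorem hasDerivAt_sin_mul_sub (k a r : ℝ) :
    HasDerivAt (fun r => Real.sin (k * (r - a))) (k * Real.cos (k * (r - a))) r := by
  have h : HasDerivAt (fun r : ℝ => k * (r - a)) k r := by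
    simpa using ((hasDerivAt_id r).sub_const a).const_mul k
  simpa [mul_comm] using h.sin

theorem hasDerivAt_cos_mul_sub (k a r : ℝ) :
    HasDerivAt (fun r => Real.cos (k * (r - a))) (-(k * Real.sin (k * (r - a)))) r := by
  have h : HasDerivAt (fun r : ℝ => k * (r - a)) k r := by
    simpa using ((hasDerivAt_id r).sub_const a).const_mul k
  simpa [mul_comm] using h.cos

theorem hasDerivAt_sin_mul_sub_left (k b r : ℝ) :
    HasDerivAt (fun r => Real.sin (k * (b - r))) (-(k * Real.cos (k * (b - r)))) r := by
  have h : HasDerivAt (fun r : ℝ => k * (b - r)) (-k) r := by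
    simpa using ((hasDerivAt_id r).const_sub b).const_mul k
  simpa [mul_comm] using h.sin

theorem hasDerivAt_cos_mul_sub_left (k b r : ℝ) :
    HasDerivAt (fun r => Real.cos (k * (b - r))) (k * Real.sin (k * (b - r))) r := by
  have h : HasDerivAt (fun r : ℝ => k * (b - r)) (-k) r := by
    simpa using ((hasDerivAt_id r).const_sub b).const_mul k
  simpa [mul_comm] using h.cos

theorem sineWeightDeriv_eq (k a b r : ℝ) :
    sineWeightDeriv k a b r = k * Real.cos (k * (r - a)) * Real.sin (k * (b - r))
      - k * Real.sin (k * (r - a)) * Real.cos (k * (b - r)) := by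
  rw [sineWeightDeriv, show k * (a + b - 2 * r) = k * (b - r) - k * (r - a) by ring, Real.sin_sub]
  ring

theorem hasDerivAt_sineWeight (k a b r : ℝ) :
    HasDerivAt (sineWeight k a b) (sineWeightDeriv k a b r) r := by
  have h := (hasDerivAt_sin_mul_sub k a r).mul (hasDerivAt_sin_mul_sub_left k b r)
  rw [sineWeightDeriv_eq]
  exact h.congr_deriv (by ring)

theorem hasDerivAt_sineWeightDeriv (k a b r : ℝ) :
    HasDerivAt (sineWeightDeriv k a b) (-(2 * k ^ 2 * Real.cos (k * (a + b - 2 * r)))) r := by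
  have h : HasDerivAt (fun r : ℝ => k * (a + b - 2 * r)) (k * -(2 * 1)) r :=
    (((hasDerivAt_id r).const_mul 2).const_sub (a + b)).const_mul k
  exact (h.sin.const_mul k).congr_deriv (by ring)

/-- The sign function `r C(r) - (q + 1) c(r)` of the generalized Pohozaev identity, where
`c` is `sineWeight` and `C = c'`. -/
noncomputable def pohozaevSign (k q a b r : ℝ) : ℝ :=
  r * sineWeightDeriv k a b r - (q + 1) * sineWeight k a b r

theorem hasDerivAt_pohozaevSign (k q a b r : ℝ) :
    HasDerivAt (pohozaevSign k q a b)
      (r * -(2 * k ^ 2 * Real.cos (k * (a + b - 2 * r))) - q * sineWeightDeriv k a b r) r := by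
  have h := ((hasDerivAt_id r).mul (hasDerivAt_sineWeightDeriv k a b r)).sub
    ((hasDerivAt_sineWeight k a b r).const_mul (q + 1))
  refine h.congr_deriv ?_
  simp only [id]
  ring

theorem continuous_pohozaevSign (k q a b : ℝ) : Continuous (pohozaevSign k q a b) :=
  continuous_iff_continuousAt.2 fun r => (hasDerivAt_pohozaevSign k q a b r).continuousAt

/-- The Wronskian of `sineWeightDeriv` and `r ^ q`; it has the sign of the derivative of
`pohozaevSign`. -/
noncomputable def weightWronskian (k q a b r : ℝ) : ℝ :=
  r ^ (q - 1) *
    (r * -(2 * k ^ 2 * Real.cos (k * (a + b - 2 * r))) - q * sineWeightDeriv k a b r)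

/-- With C = `sineWeightDeriv`, C'' = -4k²C and (r^q)'' = q(q-1)r^(q-2), so the derivative of the
Wronskian is C times an explicit factor whose only positive zero is the turning radius. -/
theorem hasDerivAt_weightWronskian (k q a b : ℝ) {r : ℝ} (hr : 0 < r) :
    HasDerivAt (weightWronskian k q a b)
      (sineWeightDeriv k a b r * r ^ (q - 2) * (q * (1 - q) - 4 * k ^ 2 * r ^ 2)) r := by
  have h0 : HasDerivAt (fun r : ℝ => k * (a + b - 2 * r)) (k * -(2 * 1)) r :=
    (((hasDerivAt_id r).const_mul 2).const_sub (a + b)).const_mul k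
  have h1 := (Real.hasDerivAt_rpow_const (x := r) (p := q - 1) (Or.inl hr.ne')).mul
    (((hasDerivAt_id r).mul ((h0.cos.const_mul (2 * k ^ 2)).neg)).sub
      ((hasDerivAt_sineWeightDeriv k a b r).const_mul q))
  have e : r ^ (q - 1) = r ^ (q - 2) * r := by
    rw [← Real.rpow_add_one hr.ne']
    ring_nf
  have e2 : q - 1 - 1 = q - 2 := by ring
  refine h1.congr_deriv ?_
  simp only [id, Pi.sub_apply, Pi.mul_apply, Pi.neg_apply, e2, e, sineWeightDeriv]
  ring

theorem sineWeightDeriv_pos {k a b r : ℝ} (hk : 0 < k) (hab : k * (b - a) < Real.pi)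
    (h1 : a ≤ r) (h2 : r < (a + b) / 2) : 0 < sineWeightDeriv k a b r := by
  refine mul_pos hk (Real.sin_pos_of_pos_of_lt_pi (mul_pos hk (by linarith))
    ((mul_le_mul_of_nonneg_left (by linarith) hk.le).trans_lt hab))

theorem sineWeight_nonneg {k a b r : ℝ} (hk : 0 < k) (hab : k * (b - a) < Real.pi)
    (hr : r ∈ Icc a b) : 0 ≤ sineWeight k a b r := by
  refine mul_nonneg (Real.sin_nonneg_of_nonneg_of_le_pi (mul_nonneg hk.le (by linarith [hr.1])) ?_)
    (Real.sin_nonneg_of_nonneg_of_le_pi (mul_nonneg hk.le (by linarith [hr.2])) ?_)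
  · exact (mul_le_mul_of_nonneg_left (by linarith [hr.2]) hk.le).trans hab.le
  · exact (mul_le_mul_of_nonneg_left (by linarith [hr.1]) hk.le).trans hab.le

theorem pohozaevSign_left_pos {k q a b : ℝ} (hk : 0 < k) (ha : 0 < a) (hab : a < b)
    (hπ : k * (b - a) < Real.pi) : 0 < pohozaevSign k q a b a := by
  have := sineWeightDeriv_pos hk hπ le_rfl (by linarith : a < (a + b) / 2)
  simp only [pohozaevSign, sineWeight, sub_self, mul_zero, Real.sin_zero, zero_mul, sub_zero]
  positivity

/-- If `weightWronskian` is nonnegative and then nonpositive on the left half of `[a, b]`, then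
`pohozaevSign` changes sign exactly once, from plus to minus. -/
theorem exists_pohozaevSign_change_of_pattern {k q a b x : ℝ} (hk : 0 < k) (ha : 0 < a)
    (hab : a < b) (hπ : k * (b - a) < Real.pi) (hq : 0 < q) (hx : x ∈ Icc a ((a + b) / 2))
    (h1 : ∀ r ∈ Ico a x, 0 ≤ weightWronskian k q a b r)
    (h2 : ∀ r ∈ Icc x ((a + b) / 2), weightWronskian k q a b r ≤ 0) :
    ∃ c ∈ Ioo a b, (∀ r ∈ Icc a c, 0 ≤ pohozaevSign k q a b r) ∧
      ∀ r ∈ Icc c b, pohozaevSign k q a b r ≤ 0 := by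
  have hcont : ∀ s : Set ℝ, ContinuousOn (pohozaevSign k q a b) s :=
    fun s => (continuous_pohozaevSign k q a b).continuousOn
  have hNa := pohozaevSign_left_pos (q := q) hk ha hab hπ
  have hmono : MonotoneOn (pohozaevSign k q a b) (Icc a x) := by
    refine monotoneOn_Icc_of_hasDerivAt (hcont _)
      (fun r _ => hasDerivAt_pohozaevSign k q a b r) fun r hr => ?_
    have h := h1 r (Ioo_subset_Ico_self hr)
    exact nonneg_of_mul_nonneg_right h (Real.rpow_pos_of_pos (ha.trans hr.1) _)
  have hanti : AntitoneOn (pohozaevSign k q a b) (Icc x ((a + b) / 2)) := by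
    refine antitoneOn_Icc_of_hasDerivAt (hcont _)
      (fun r _ => hasDerivAt_pohozaevSign k q a b r) fun r hr => ?_
    have h := h2 r (Ioo_subset_Icc_self hr)
    exact nonpos_of_mul_nonpos_right h
      (Real.rpow_pos_of_pos (ha.trans_le (hx.1.trans hr.1.le)) _)
  have hleft : ∀ r ∈ Icc a x, 0 < pohozaevSign k q a b r := fun r hr =>
    hNa.trans_le (hmono (left_mem_Icc.2 hx.1) hr hr.1)
  -- To the right of the midpoint the weight is nonnegative and decreasing, so both terms are
  -- nonpositive.
  have hright : ∀ r ∈ Icc ((a + b) / 2) b, pohozaevSign k q a b r ≤ 0 := by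
    intro r hr
    have hc := sineWeight_nonneg hk hπ (r := r) ⟨by linarith [hr.1], hr.2⟩
    have hC : sineWeightDeriv k a b r ≤ 0 := by
      refine mul_nonpos_of_nonneg_of_nonpos hk.le
        (Real.sin_nonpos_of_nonpos_of_neg_pi_le ?_ ?_)
      · exact mul_nonpos_of_nonneg_of_nonpos hk.le (by linarith [hr.1])
      · have : k * (2 * r - a - b) ≤ k * (b - a) :=
          mul_le_mul_of_nonneg_left (by linarith [hr.1, hr.2]) hk.le
        linarith
    have hr0 : 0 < r := by linarith [hr.1]
    have := mul_nonpos_of_nonneg_of_nonpos hr0.le hC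
    have := mul_nonneg (by linarith : 0 ≤ q + 1) hc
    simp only [pohozaevSign]
    linarith
  have hmid : pohozaevSign k q a b ((a + b) / 2) < 0 := by
    have hs : 0 < Real.sin (k * ((b - a) / 2)) := by
      refine Real.sin_pos_of_pos_of_lt_pi (mul_pos hk (by linarith)) ?_
      have := mul_pos hk (sub_pos.2 hab)
      linarith
    have : pohozaevSign k q a b ((a + b) / 2) = -((q + 1) * (Real.sin (k * ((b - a) / 2))) ^ 2) := by
      simp only [pohozaevSign, sineWeight, sineWeightDeriv]
      rw [show a + b - 2 * ((a + b) / 2) = 0 by ring, show (a + b) / 2 - a = (b - a) / 2 by ring,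
        show b - (a + b) / 2 = (b - a) / 2 by ring]
      rw [mul_zero, Real.sin_zero]
      ring
    rw [this]
    have : 0 < (q + 1) * (Real.sin (k * ((b - a) / 2))) ^ 2 := by positivity
    linarith
  obtain ⟨c, hc, hc0⟩ := intermediate_value_Icc' hx.2 (hcont _)
    ⟨hmid.le, (hleft x (right_mem_Icc.2 hx.1)).le⟩
  -- If x = a, the zero c could coincide with a; positivity at a excludes this.
  have hca : a < c := by
    rcases hx.1.eq_or_lt with h | h
    · refine lt_of_le_of_ne (h ▸ hc.1) fun h' => ?_
      rw [← h'] at hc0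
      linarith
    · exact h.trans_le hc.1
  refine ⟨c, ⟨hca, by linarith [hc.2]⟩, fun r hr => ?_, fun r hr => ?_⟩
  · rcases le_total r x with h | h
    · exact (hleft r ⟨hr.1, h⟩).le
    · rw [← hc0]
      exact hanti ⟨h, hr.2.trans hc.2⟩ hc hr.2
  · rcases le_total r ((a + b) / 2) with h | h
    · rw [← hc0]
      exact hanti hc ⟨hc.1.trans hr.1, h⟩ hr.1
    · exact hright r ⟨h, hr.2⟩

/-- `pohozaevSign` changes sign exactly once if the turning radius `ρ` lies outside `(a, b)`, or
if `weightWronskian` is nonnegative at `a` or nonpositive at `ρ`. -/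
theorem exists_pohozaevSign_change {k q a b ρ : ℝ} (hk : 0 < k) (ha : 0 < a)
    (hab : a < b) (hπ : k * (b - a) < Real.pi) (hq : 0 < q) (hρ : 0 ≤ ρ)
    (hρq : 4 * k ^ 2 * ρ ^ 2 = q * (1 - q))
    (h : ρ ≤ a ∨ (a + b) / 2 ≤ ρ ∨ 0 ≤ weightWronskian k q a b a ∨
      weightWronskian k q a b ρ ≤ 0) :
    ∃ c ∈ Ioo a b, (∀ r ∈ Icc a c, 0 ≤ pohozaevSign k q a b r) ∧
      ∀ r ∈ Icc c b, pohozaevSign k q a b r ≤ 0 := by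
  set D := weightWronskian k q a b with hD
  have hder : ∀ r, a ≤ r → HasDerivAt D
      (sineWeightDeriv k a b r * r ^ (q - 2) * (q * (1 - q) - 4 * k ^ 2 * r ^ 2)) r :=
    fun r hr => hasDerivAt_weightWronskian k q a b (ha.trans_le hr)
  have hcont : ∀ x y, a ≤ x → ContinuousOn D (Icc x y) := fun x y hx r hr =>
    (hder r (hx.trans hr.1)).continuousAt.continuousWithinAt
  have hfac : ∀ r, a ≤ r → r < (a + b) / 2 → 0 ≤ sineWeightDeriv k a b r * r ^ (q - 2) :=
    fun r h1 h2 => mul_nonneg (sineWeightDeriv_pos hk hπ h1 h2).le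
      (Real.rpow_nonneg (ha.le.trans h1) _)
  have hmono : ∀ y, y ≤ ρ → y ≤ (a + b) / 2 → MonotoneOn D (Icc a y) := by
    intro y hy hy2
    refine monotoneOn_Icc_of_hasDerivAt (hcont _ _ le_rfl) (fun r hr => hder r hr.1.le) ?_
    intro r hr
    refine mul_nonneg (hfac r hr.1.le (hr.2.trans_le hy2)) ?_
    rw [← hρq]
    have : r ^ 2 ≤ ρ ^ 2 := pow_le_pow_left₀ (ha.trans hr.1).le (hr.2.le.trans hy) 2
    nlinarith [sq_nonneg k]
  have hanti : ∀ x, a ≤ x → ρ ≤ x → AntitoneOn D (Icc x ((a + b) / 2)) := by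
    intro x hx hxρ
    refine antitoneOn_Icc_of_hasDerivAt (hcont _ _ hx) (fun r hr => hder r (hx.trans hr.1.le)) ?_
    intro r hr
    refine mul_nonpos_of_nonneg_of_nonpos (hfac r (hx.trans hr.1.le) hr.2) ?_
    rw [← hρq]
    have : ρ ^ 2 ≤ r ^ 2 := pow_le_pow_left₀ hρ (hxρ.trans hr.1.le) 2
    nlinarith [sq_nonneg k]
  have hmid : D ((a + b) / 2) ≤ 0 := by
    simp only [hD, weightWronskian, sineWeightDeriv]
    rw [show a + b - 2 * ((a + b) / 2) = 0 by ring]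
    simp only [mul_zero, Real.cos_zero, Real.sin_zero, sub_zero]
    refine mul_nonpos_of_nonneg_of_nonpos (Real.rpow_nonneg (by linarith) _) ?_
    nlinarith [sq_nonneg k]
  have hM : a ≤ (a + b) / 2 := by linarith
  -- a nonnegative value of `D` at some `y ≥ ρ` is followed by exactly one sign change
  have hpass : ∀ y ∈ Icc a ((a + b) / 2), ρ ≤ y → (∀ r ∈ Icc a y, 0 ≤ D r) →
      ∃ c ∈ Ioo a b, (∀ r ∈ Icc a c, 0 ≤ pohozaevSign k q a b r) ∧
        ∀ r ∈ Icc c b, pohozaevSign k q a b r ≤ 0 := by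
    intro y hy hyρ hpos
    obtain ⟨x, hx, hx0⟩ := intermediate_value_Icc' hy.2 (hcont y _ hy.1)
      ⟨hmid, hpos y (right_mem_Icc.2 hy.1)⟩
    refine exists_pohozaevSign_change_of_pattern hk ha hab hπ hq (x := x)
      ⟨hy.1.trans hx.1, hx.2⟩ (fun r hr => ?_) fun r hr => ?_
    · rcases le_total r y with h' | h'
      · exact hpos r ⟨hr.1, h'⟩
      · rw [← hD, ← hx0]
        exact hanti y hy.1 hyρ ⟨h', hr.2.le.trans hx.2⟩ hx hr.2.le
    · rw [← hD, ← hx0]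
      exact hanti y hy.1 hyρ hx ⟨hx.1.trans hr.1, hr.2⟩ hr.1
  -- The degenerate pattern x = a, in which the interval of nonnegativity is empty.
  have hneg : (∀ r ∈ Icc a ((a + b) / 2), D r ≤ 0) →
      ∃ c ∈ Ioo a b, (∀ r ∈ Icc a c, 0 ≤ pohozaevSign k q a b r) ∧
        ∀ r ∈ Icc c b, pohozaevSign k q a b r ≤ 0 := fun hall =>
    exists_pohozaevSign_change_of_pattern hk ha hab hπ hq (left_mem_Icc.2 hM)
      (fun r hr => absurd hr.2 (not_lt.2 hr.1)) hall
  by_cases h1 : ρ ≤ a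
  · rcases le_total (D a) 0 with h' | h'
    · exact hneg fun r hr => (hanti a le_rfl h1 (left_mem_Icc.2 hM) hr hr.1).trans h'
    · refine hpass a (left_mem_Icc.2 hM) h1 fun r hr => ?_
      rwa [le_antisymm hr.2 hr.1]
  -- Here D increases on the whole left half up to its nonpositive value at the midpoint.
  by_cases h2 : (a + b) / 2 ≤ ρ
  · exact hneg fun r hr => (hmono _ h2 le_rfl hr (right_mem_Icc.2 hM) hr.2).trans hmid
  push Not at h1 h2
  rcases h with h | h | h | h
  · exact absurd h h1.not_ge
  · exact absurd h h2.not_ge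
  · exact hpass ρ ⟨h1.le, h2.le⟩ le_rfl fun r hr =>
      h.trans (hmono ρ le_rfl h2.le (left_mem_Icc.2 h1.le) hr hr.1)
  · refine hneg fun r hr => ?_
    rcases le_total r ρ with h' | h'
    · exact (hmono ρ le_rfl h2.le ⟨hr.1, h'⟩ (right_mem_Icc.2 h1.le) h').trans h
    · exact (hanti ρ h1.le le_rfl (left_mem_Icc.2 h2.le) ⟨h', hr.2⟩ h').trans h

/-! ### The reduced equation and its Pohozaev functional -/

/-- `w`, with derivative `d`, is a positive solution of
`w'' + k ^ 2 * w + r ^ (1 - p) * w ^ p = 0` on `[a, b]` that vanishes at `a` and `b`. -/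
structure IsReducedSolution (k p a b : ℝ) (w d : ℝ → ℝ) : Prop where
  hasDerivWithinAt_fst : ∀ r ∈ Icc a b, HasDerivWithinAt w (d r) (Icc a b) r
  hasDerivWithinAt_snd : ∀ r ∈ Icc a b,
    HasDerivWithinAt d (-(k ^ 2 * w r + r ^ (1 - p) * w r ^ p)) (Icc a b) r
  left_boundary : w a = 0
  right_boundary : w b = 0
  pos : ∀ r ∈ Ioo a b, 0 < w r

/-- The generalized Pohozaev functional with weight `sineWeight`. -/
noncomputable def pohozaev (k p a b : ℝ) (w d : ℝ → ℝ) (r : ℝ) : ℝ :=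
  1 / 2 * ((Real.sin (k * (r - a)) * d r - k * Real.cos (k * (r - a)) * w r) *
    (Real.sin (k * (b - r)) * d r + k * Real.cos (k * (b - r)) * w r)) +
  sineWeight k a b r * (r ^ (1 - p) * w r ^ (p + 1)) / (p + 1)

namespace IsReducedSolution

variable {k p a b : ℝ} {w d w₁ d₁ w₂ d₂ : ℝ → ℝ}

theorem continuousOn_fst (h : IsReducedSolution k p a b w d) : ContinuousOn w (Icc a b) :=
  fun r hr => (h.hasDerivWithinAt_fst r hr).continuousWithinAt

theorem continuousOn_snd (h : IsReducedSolution k p a b w d) : ContinuousOn d (Icc a b) :=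
  fun r hr => (h.hasDerivWithinAt_snd r hr).continuousWithinAt

theorem hasDerivAt_fst (h : IsReducedSolution k p a b w d) {r : ℝ} (hr : r ∈ Ioo a b) :
    HasDerivAt w (d r) r :=
  (h.hasDerivWithinAt_fst r (Ioo_subset_Icc_self hr)).hasDerivAt (Icc_mem_nhds hr.1 hr.2)

theorem hasDerivAt_snd (h : IsReducedSolution k p a b w d) {r : ℝ} (hr : r ∈ Ioo a b) :
    HasDerivAt d (-(k ^ 2 * w r + r ^ (1 - p) * w r ^ p)) r :=
  (h.hasDerivWithinAt_snd r (Ioo_subset_Icc_self hr)).hasDerivAt (Icc_mem_nhds hr.1 hr.2)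

theorem nonneg (h : IsReducedSolution k p a b w d) {r : ℝ} (hr : r ∈ Icc a b) : 0 ≤ w r := by
  rcases hr.1.eq_or_lt with rfl | h1
  · exact h.left_boundary.ge
  rcases hr.2.eq_or_lt with rfl | h2
  · exact h.right_boundary.ge
  exact (h.pos r ⟨h1, h2⟩).le

theorem continuousOn_pohozaev (h : IsReducedSolution k p a b w d) (ha : 0 < a) (hp : 0 < p) :
    ContinuousOn (pohozaev k p a b w d) (Icc a b) := by
  have hw := h.continuousOn_fst
  have hd := h.continuousOn_snd
  have h1 : ContinuousOn (fun r : ℝ => r ^ (1 - p)) (Icc a b) := fun r hr =>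
    (Real.continuousAt_rpow_const _ _ (Or.inl (ha.trans_le hr.1).ne')).continuousWithinAt
  have h2 : ContinuousOn (fun r => w r ^ (p + 1)) (Icc a b) :=
    hw.rpow_const fun _ _ => Or.inr (by linarith)
  have h3 : Continuous (sineWeight k a b) := by
    unfold sineWeight
    fun_prop
  unfold pohozaev
  fun_prop

/-- The sine solves the linear part y'' + k²y = 0, so only the nonlinear term survives. The same
holds at the right end. -/
theorem hasDerivAt_wronskian_left (h : IsReducedSolution k p a b w d) {r : ℝ}
    (hr : r ∈ Ioo a b) :
    HasDerivAt (fun r => Real.sin (k * (r - a)) * d r - k * Real.cos (k * (r - a)) * w r)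
      (-(Real.sin (k * (r - a)) * (r ^ (1 - p) * w r ^ p))) r := by
  refine (((hasDerivAt_sin_mul_sub k a r).mul (h.hasDerivAt_snd hr)).sub
    (((hasDerivAt_cos_mul_sub k a r).const_mul k).mul (h.hasDerivAt_fst hr))).congr_deriv ?_
  ring

theorem hasDerivAt_wronskian_right (h : IsReducedSolution k p a b w d) {r : ℝ}
    (hr : r ∈ Ioo a b) :
    HasDerivAt (fun r => Real.sin (k * (b - r)) * d r + k * Real.cos (k * (b - r)) * w r)
      (-(Real.sin (k * (b - r)) * (r ^ (1 - p) * w r ^ p))) r := by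
  refine (((hasDerivAt_sin_mul_sub_left k b r).mul (h.hasDerivAt_snd hr)).add
    (((hasDerivAt_cos_mul_sub_left k b r).const_mul k).mul (h.hasDerivAt_fst hr))).congr_deriv ?_
  ring

/-- The expression vanishes at a and decreases, the sine being nonnegative because k(b-a) < π.
Together with its mirror image at b, this makes the quadratic part of `pohozaev` nonpositive. -/
theorem wronskian_left_nonpos (h : IsReducedSolution k p a b w d) (hk : 0 < k) (ha : 0 < a)
    (hπ : k * (b - a) < Real.pi) {r : ℝ} (hr : r ∈ Icc a b) :
    Real.sin (k * (r - a)) * d r - k * Real.cos (k * (r - a)) * w r ≤ 0 := by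
  have hw := h.continuousOn_fst
  have hd := h.continuousOn_snd
  have hanti := antitoneOn_Icc_of_hasDerivAt (a := a) (b := b)
    (f := fun r => Real.sin (k * (r - a)) * d r - k * Real.cos (k * (r - a)) * w r) (by fun_prop)
    (fun r hr => h.hasDerivAt_wronskian_left hr) fun x hx => by
      have h1 : 0 ≤ Real.sin (k * (x - a)) := Real.sin_nonneg_of_nonneg_of_le_pi
        (mul_nonneg hk.le (by linarith [hx.1]))
        ((mul_le_mul_of_nonneg_left (by linarith [hx.2]) hk.le).trans hπ.le)
      have h2 := Real.rpow_nonneg (ha.trans hx.1).le (1 - p)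
      have h3 := Real.rpow_nonneg (h.pos x hx).le p
      have := mul_nonneg h1 (mul_nonneg h2 h3)
      linarith
  have := hanti (left_mem_Icc.2 (hr.1.trans hr.2)) hr hr.1
  simpa [h.left_boundary] using this

theorem wronskian_right_nonneg (h : IsReducedSolution k p a b w d) (hk : 0 < k) (ha : 0 < a)
    (hπ : k * (b - a) < Real.pi) {r : ℝ} (hr : r ∈ Icc a b) :
    0 ≤ Real.sin (k * (b - r)) * d r + k * Real.cos (k * (b - r)) * w r := by
  have hw := h.continuousOn_fst
  have hd := h.continuousOn_snd
  have hanti := antitoneOn_Icc_of_hasDerivAt (a := a) (b := b)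
    (f := fun r => Real.sin (k * (b - r)) * d r + k * Real.cos (k * (b - r)) * w r) (by fun_prop)
    (fun r hr => h.hasDerivAt_wronskian_right hr) fun x hx => by
      have h1 : 0 ≤ Real.sin (k * (b - x)) := Real.sin_nonneg_of_nonneg_of_le_pi
        (mul_nonneg hk.le (by linarith [hx.2]))
        ((mul_le_mul_of_nonneg_left (by linarith [hx.1]) hk.le).trans hπ.le)
      have h2 := Real.rpow_nonneg (ha.trans hx.1).le (1 - p)
      have h3 := Real.rpow_nonneg (h.pos x hx).le p
      have := mul_nonneg h1 (mul_nonneg h2 h3)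
      linarith
  have := hanti hr (right_mem_Icc.2 (hr.1.trans hr.2)) hr.2
  simpa [h.right_boundary] using this

theorem pohozaev_left (h : IsReducedSolution k p a b w d) : pohozaev k p a b w d a = 0 := by
  simp [pohozaev, sineWeight, h.left_boundary]

theorem pohozaev_right (h : IsReducedSolution k p a b w d) : pohozaev k p a b w d b = 0 := by
  simp [pohozaev, sineWeight, h.right_boundary]

/-- The generalized Pohozaev identity. -/
theorem hasDerivAt_pohozaev (h : IsReducedSolution k p a b w d) (ha : 0 < a) (hp : 0 < p) {r : ℝ}
    (hr : r ∈ Ioo a b) :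
    HasDerivAt (pohozaev k p a b w d)
      ((p + 3) / (2 * (p + 1)) * (r ^ (-p) * w r ^ (p + 1)) *
        pohozaevSign k ((p - 5) / (p + 3)) a b r) r := by
  have hr0 : 0 < r := ha.trans hr.1
  have hw0 := h.pos r hr
  have hT := ((h.hasDerivAt_wronskian_left hr).mul (h.hasDerivAt_wronskian_right hr)).const_mul
    (1 / 2 : ℝ)
  have hR := (((hasDerivAt_sineWeight k a b r).mul
    ((Real.hasDerivAt_rpow_const (x := r) (p := 1 - p) (Or.inl hr0.ne')).mul
      ((h.hasDerivAt_fst hr).rpow_const (p := p + 1) (Or.inl hw0.ne')))).div_const (p + 1))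
  -- The terms containing d cancel. What is left has coefficient 1/2 + 1/(p+1) = (p+3)/(2(p+1)) on
  -- rc' and (1-p)/(p+1) on c, and their quotient gives q + 1 = 2(p-1)/(p+3).
  refine (hT.add hR).congr_deriv ?_
  have e1 : r ^ (1 - p) = r * r ^ (-p) := by
    rw [sub_eq_add_neg, Real.rpow_add hr0, Real.rpow_one]
  have e2 : w r ^ (p + 1) = w r * w r ^ p := by
    rw [Real.rpow_add hw0, Real.rpow_one, mul_comm]
  have e3 : (1 - p - 1 : ℝ) = -p := by ring
  have e4 : (p + 1 - 1 : ℝ) = p := by ring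
  simp only [Pi.mul_apply, e3, e4, e1, e2, pohozaevSign, sineWeight, sineWeightDeriv_eq]
  have hp1 : p + 1 ≠ 0 := by linarith
  have hp3 : p + 3 ≠ 0 := by linarith
  field_simp
  ring

/-- The functional vanishes at both ends, increases up to c and decreases after it. -/
theorem pohozaev_nonneg (h : IsReducedSolution k p a b w d) (ha : 0 < a) (hp : 0 < p) {c : ℝ}
    (hc : c ∈ Ioo a b) (h1 : ∀ r ∈ Icc a c, 0 ≤ pohozaevSign k ((p - 5) / (p + 3)) a b r)
    (h2 : ∀ r ∈ Icc c b, pohozaevSign k ((p - 5) / (p + 3)) a b r ≤ 0) {r : ℝ}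
    (hr : r ∈ Icc a b) : 0 ≤ pohozaev k p a b w d r := by
  have hJ := h.continuousOn_pohozaev ha hp
  have hfac : ∀ r ∈ Ioo a b, 0 ≤ (p + 3) / (2 * (p + 1)) * (r ^ (-p) * w r ^ (p + 1)) :=
    fun r hr => mul_nonneg (by positivity) (mul_nonneg (Real.rpow_nonneg (ha.trans hr.1).le _)
      (Real.rpow_nonneg (h.pos r hr).le _))
  rcases le_total r c with hrc | hrc
  · rw [← h.pohozaev_left]
    refine monotoneOn_Icc_of_hasDerivAt (hJ.mono (Icc_subset_Icc_right hc.2.le))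
      (fun x hx => h.hasDerivAt_pohozaev ha hp ⟨hx.1, hx.2.trans hc.2⟩)
      (fun x hx => mul_nonneg (hfac x ⟨hx.1, hx.2.trans hc.2⟩) (h1 x (Ioo_subset_Icc_self hx)))
      (left_mem_Icc.2 hc.1.le) ⟨hr.1, hrc⟩ hr.1
  · rw [← h.pohozaev_right]
    refine antitoneOn_Icc_of_hasDerivAt (hJ.mono (Icc_subset_Icc_left hc.1.le))
      (fun x hx => h.hasDerivAt_pohozaev ha hp ⟨hc.1.trans hx.1, hx.2⟩)
      (fun x hx => mul_nonpos_of_nonneg_of_nonpos (hfac x ⟨hc.1.trans hx.1, hx.2⟩)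
        (h2 x (Ioo_subset_Icc_self hx))) ⟨hrc, hr.2⟩ (right_mem_Icc.2 hc.2.le) hr.2

theorem hasDerivAt_wronskian (h₁ : IsReducedSolution k p a b w₁ d₁)
    (h₂ : IsReducedSolution k p a b w₂ d₂) {r : ℝ} (hr : r ∈ Ioo a b) :
    HasDerivAt (fun r => d₂ r * w₁ r - w₂ r * d₁ r)
      (r ^ (1 - p) * (w₂ r * w₁ r ^ p - w₁ r * w₂ r ^ p)) r := by
  refine (((h₂.hasDerivAt_snd hr).mul (h₁.hasDerivAt_fst hr)).sub
    ((h₂.hasDerivAt_fst hr).mul (h₁.hasDerivAt_snd hr))).congr_deriv ?_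
  ring

/-- The derivative of the Wronskian is positive where `w₂ < w₁`. -/
theorem wronskian_deriv_pos (h₁ : IsReducedSolution k p a b w₁ d₁)
    (h₂ : IsReducedSolution k p a b w₂ d₂) (ha : 0 < a) (hp : 1 < p) {r : ℝ} (hr : r ∈ Ioo a b)
    (hlt : w₂ r < w₁ r) : 0 < r ^ (1 - p) * (w₂ r * w₁ r ^ p - w₁ r * w₂ r ^ p) := by
  have hw1 := h₁.pos r hr
  have hw2 := h₂.pos r hr
  have e : ∀ x : ℝ, 0 < x → x ^ p = x * x ^ (p - 1) := fun x hx => by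
    rw [← Real.rpow_one_add' hx.le (by linarith)]
    ring_nf
  have hpow : w₂ r ^ (p - 1) < w₁ r ^ (p - 1) := Real.rpow_lt_rpow hw2.le hlt (by linarith)
  refine mul_pos (Real.rpow_pos_of_pos (ha.trans hr.1) _) ?_
  rw [e _ hw1, e _ hw2]
  have := mul_pos (mul_pos hw1 hw2) (sub_pos.2 hpow)
  linarith

/-- If `w₂` leaves `a` with the smaller slope, then `w₂ / w₁` increases strictly up to a point `s`
at which the logarithmic derivatives agree, and `w₁ ≤ w₂` there. -/
theorem exists_wronskian_zero (h₁ : IsReducedSolution k p a b w₁ d₁)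
    (h₂ : IsReducedSolution k p a b w₂ d₂) (ha : 0 < a) (hab : a < b) (hp : 1 < p)
    (hslope : d₂ a < d₁ a) :
    ∃ s ∈ Ioc a b, d₂ s * w₁ s - w₂ s * d₁ s = 0 ∧
      StrictMonoOn (fun r => w₂ r / w₁ r) (Ioc a s ∩ Iio b) ∧ (s < b → w₁ s ≤ w₂ s) := by
  have hw1 := h₁.continuousOn_fst
  have hd1 := h₁.continuousOn_snd
  have hw2 := h₂.continuousOn_fst
  have hd2 := h₂.continuousOn_snd
  set W : ℝ → ℝ := fun r => d₂ r * w₁ r - w₂ r * d₁ r with hW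
  have hWc : ContinuousOn W (Icc a b) := by fun_prop
  have hWa : W a = 0 := by simp [hW, h₁.left_boundary, h₂.left_boundary]
  have hWb : W b = 0 := by simp [hW, h₁.right_boundary, h₂.right_boundary]
  obtain ⟨x, hx, hxpos⟩ := exists_forall_pos_of_continuousOn hab (f := fun r => d₁ r - d₂ r)
    (by fun_prop) (sub_pos.2 hslope)
  have hdiff : StrictMonoOn (fun r => w₁ r - w₂ r) (Icc a x) := by
    refine strictMonoOn_Icc_of_hasDerivAt ((hw1.fun_sub hw2).mono (Icc_subset_Icc_right hx.2.le))
      (fun r hr => ?_) fun r hr => hxpos r (Ioo_subset_Icc_self hr)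
    exact (h₁.hasDerivAt_fst ⟨hr.1, hr.2.trans hx.2⟩).sub
      (h₂.hasDerivAt_fst ⟨hr.1, hr.2.trans hx.2⟩)
  have hlt : ∀ r ∈ Ioc a x, w₂ r < w₁ r := fun r hr => by
    have := hdiff (left_mem_Icc.2 hx.1.le) (Ioc_subset_Icc_self hr) hr.1
    simp only [h₁.left_boundary, h₂.left_boundary, sub_self] at this
    linarith
  have hWmono : ∀ y ∈ Ioo a b, (∀ r ∈ Ioo a y, w₂ r < w₁ r) → StrictMonoOn W (Icc a y) :=
    fun y hy hyl => strictMonoOn_Icc_of_hasDerivAt (hWc.mono (Icc_subset_Icc_right hy.2.le))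
      (fun r hr => h₁.hasDerivAt_wronskian h₂ ⟨hr.1, hr.2.trans hy.2⟩)
      fun r hr => h₁.wronskian_deriv_pos h₂ ha hp ⟨hr.1, hr.2.trans hy.2⟩ (hyl r hr)
  have hWx : ∀ r ∈ Ioc a x, 0 < W r := fun r hr => by
    rw [← hWa]
    exact hWmono x hx (fun r hr => hlt r (Ioo_subset_Ioc_self hr)) (left_mem_Icc.2 hx.1.le)
      (Ioc_subset_Icc_self hr) hr.1
  -- The first point at which the Wronskian is no longer positive; one exists because the Wronskian
  -- vanishes at b.
  obtain ⟨s, ⟨hsm, hs0⟩, hsl⟩ : ∃ s, IsLeast (Icc x b ∩ W ⁻¹' Iic 0) s := by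
    refine IsCompact.exists_isLeast ?_ ⟨b, right_mem_Icc.2 hx.2.le, hWb.le⟩
    exact isCompact_Icc.of_isClosed_subset
      ((hWc.mono (Icc_subset_Icc_left hx.1.le)).preimage_isClosed_of_isClosed isClosed_Icc
        isClosed_Iic) inter_subset_left
  have hxs : x < s := lt_of_le_of_ne hsm.1 fun h => by
    have h1 := hWx x ⟨hx.1, le_rfl⟩
    rw [h] at h1
    exact absurd h1 (not_lt.2 hs0)
  have has : a < s := hx.1.trans hxs
  have hWpos : ∀ r ∈ Ioo a s, 0 < W r := fun r hr => by
    rcases le_total r x with h | h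
    · exact hWx r ⟨hr.1, h⟩
    · by_contra hn
      exact absurd hr.2 (not_lt.2 (hsl ⟨⟨h, hr.2.le.trans hsm.2⟩, not_lt.1 hn⟩))
  have hWs : W s = 0 := by
    refine le_antisymm hs0 ?_
    have hcl : s ∈ closure (Ioo a s) := by
      rw [closure_Ioo has.ne]
      exact right_mem_Icc.2 has.le
    refine ContinuousWithinAt.closure_le (f := fun _ => (0 : ℝ)) hcl
      continuousWithinAt_const ((hWc s ⟨has.le, hsm.2⟩).mono fun r hr =>
        ⟨hr.1.le, hr.2.le.trans hsm.2⟩) fun r hr => (hWpos r hr).le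
  have hρ : ∀ r ∈ Ioo a b, HasDerivAt (fun r => w₂ r / w₁ r) (W r / w₁ r ^ 2) r := fun r hr =>
    (h₂.hasDerivAt_fst hr).fun_div (h₁.hasDerivAt_fst hr) (h₁.pos r hr).ne'
  have hρpos : ∀ r ∈ Ioo a s, 0 < W r / w₁ r ^ 2 := fun r hr =>
    div_pos (hWpos r hr) (pow_pos (h₁.pos r ⟨hr.1, hr.2.trans_le hsm.2⟩) 2)
  -- The endpoint b is excluded even if s = b: both solutions vanish there and the quotient takes
  -- the default value 0.
  have hm : StrictMonoOn (fun r => w₂ r / w₁ r) (Ioc a s ∩ Iio b) := by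
    have hint : interior (Ioc a s ∩ Iio b) ⊆ Ioo a s := by
      rw [← interior_Ioc (a := a) (b := s)]
      exact interior_mono inter_subset_left
    refine strictMonoOn_of_hasDerivWithinAt_pos ((convex_Ioc a s).inter (convex_Iio b))
      (fun r hr => (hρ r ⟨hr.1.1, hr.2⟩).continuousAt.continuousWithinAt)
      (fun r hr => (hρ r ⟨(hint hr).1, (hint hr).2.trans_le hsm.2⟩).hasDerivWithinAt)
      fun r hr => hρpos r (hint hr)
  refine ⟨s, ⟨has, hsm.2⟩, hWs, hm, fun hsb => ?_⟩
  -- If w₂ < w₁ at s, the increasing ratio is below 1 on all of (a, s); then the Wronskian increases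
  -- strictly from 0 and cannot vanish at s.
  by_contra hcon
  push Not at hcon
  have hall : ∀ r ∈ Ioo a s, w₂ r < w₁ r := fun r hr => by
    have h0 := h₁.pos r ⟨hr.1, hr.2.trans hsb⟩
    have h1 := hm ⟨Ioo_subset_Ioc_self hr, hr.2.trans hsb⟩ ⟨right_mem_Ioc.2 has, hsb⟩ hr.2
    have h2 : w₂ s / w₁ s < 1 := (div_lt_one (h₁.pos s ⟨has, hsb⟩)).2 hcon
    exact (div_lt_one h0).1 (h1.trans h2)
  have := hWmono s ⟨has, hsb⟩ hall (left_mem_Icc.2 has.le) (right_mem_Icc.2 has.le) has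
  linarith

end IsReducedSolution

/-! ### Uniqueness for the reduced problem -/

/-- The nonlinearity `k ^ 2 * y + t ^ (1 - p) * y ^ p` is Lipschitz for `0 ≤ y ≤ M`, uniformly in
`t ≥ a`. -/
theorem abs_nonlinearity_sub_le {k p a M : ℝ} (ha : 0 < a) (hp : 1 ≤ p) {t y z : ℝ} (ht : a ≤ t)
    (hy : y ∈ Icc 0 M) (hz : z ∈ Icc 0 M) :
    |(k ^ 2 * y + t ^ (1 - p) * y ^ p) - (k ^ 2 * z + t ^ (1 - p) * z ^ p)| ≤
      (k ^ 2 + a ^ (1 - p) * (p * M ^ (p - 1))) * |y - z| := by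
  have h := Convex.norm_image_sub_le_of_norm_hasDerivWithin_le
    (f := fun y : ℝ => k ^ 2 * y + t ^ (1 - p) * y ^ p)
    (f' := fun y => k ^ 2 * 1 + t ^ (1 - p) * (p * y ^ (p - 1))) (s := Icc 0 M) (x := z) (y := y)
    (C := k ^ 2 + a ^ (1 - p) * (p * M ^ (p - 1)))
    (fun x _ => ((((hasDerivAt_id x).const_mul (k ^ 2)).add
      ((Real.hasDerivAt_rpow_const (Or.inr hp)).const_mul (t ^ (1 - p)))).hasDerivWithinAt))
    (fun x hx => ?_) (convex_Icc 0 M) hz hy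
  · simpa only [Real.norm_eq_abs] using h
  · have h1 : 0 ≤ t ^ (1 - p) := Real.rpow_nonneg (ha.le.trans ht) _
    have h2 : 0 ≤ x ^ (p - 1) := Real.rpow_nonneg hx.1 _
    have h3 : t ^ (1 - p) ≤ a ^ (1 - p) := Real.rpow_le_rpow_of_nonpos ha ht (by linarith)
    have h4 : x ^ (p - 1) ≤ M ^ (p - 1) := Real.rpow_le_rpow hx.1 hx.2 (by linarith)
    rw [Real.norm_of_nonneg (by positivity), mul_one]
    gcongr

namespace IsReducedSolution

variable {k p a b : ℝ} {w d w₁ d₁ w₂ d₂ : ℝ → ℝ}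

/-- Two reduced solutions cannot leave `a` with different slopes. -/
theorem not_slope_lt (h₁ : IsReducedSolution k p a b w₁ d₁)
    (h₂ : IsReducedSolution k p a b w₂ d₂) (hk : 0 < k) (ha : 0 < a) (hab : a < b) (hp : 1 < p)
    (hπ : k * (b - a) < Real.pi)
    (hN : ∃ c ∈ Ioo a b, (∀ r ∈ Icc a c, 0 ≤ pohozaevSign k ((p - 5) / (p + 3)) a b r) ∧
      ∀ r ∈ Icc c b, pohozaevSign k ((p - 5) / (p + 3)) a b r ≤ 0) :
    ¬ d₂ a < d₁ a := by
  intro hslope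
  have hp0 : 0 < p := by linarith
  obtain ⟨c, hc, hNpos, hNneg⟩ := hN
  obtain ⟨s, hs, hWs, hmono, hle⟩ := h₁.exists_wronskian_zero h₂ ha hab hp hslope
  set N := pohozaevSign k ((p - 5) / (p + 3)) a b with hNdef
  obtain ⟨y, hy, hyN⟩ := exists_forall_pos_of_continuousOn hab
    (continuous_pohozaevSign k ((p - 5) / (p + 3)) a b).continuousOn
    (pohozaevSign_left_pos hk ha hab hπ)
  set x := min c s with hx
  have hax : a < x := lt_min hc.1 hs.1
  have hxb : x < b := (min_le_left _ _).trans_lt hc.2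
  have hxs : x ≤ s := min_le_right _ _
  have hxmem : x ∈ Ioc a s ∩ Iio b := ⟨⟨hax, hxs⟩, hxb⟩
  -- With this constant, the factor σ - (w₂/w₁)^(p+1) in Z' changes sign together with N at c. If s
  -- < c, then x = s and both factors are nonnegative on all of (a, s).
  set σ := (w₂ x / w₁ x) ^ (p + 1) with hσ
  set Z : ℝ → ℝ := fun r => σ * pohozaev k p a b w₁ d₁ r - pohozaev k p a b w₂ d₂ r with hZ
  have hJ₁ := h₁.continuousOn_pohozaev ha hp0
  have hJ₂ := h₂.continuousOn_pohozaev ha hp0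
  have hZc : ContinuousOn Z (Icc a b) := by fun_prop
  have hZa : Z a = 0 := by simp [hZ, h₁.pohozaev_left, h₂.pohozaev_left]
  have hZd : ∀ r ∈ Ioo a b, HasDerivAt Z ((p + 3) / (2 * (p + 1)) * r ^ (-p) *
      (N r * (w₁ r ^ (p + 1) * (σ - (w₂ r / w₁ r) ^ (p + 1))))) r := fun r hr => by
    refine (((h₁.hasDerivAt_pohozaev ha hp0 hr).const_mul σ).sub
      (h₂.hasDerivAt_pohozaev ha hp0 hr)).congr_deriv ?_
    have hw := h₁.pos r hr
    rw [Real.div_rpow (h₂.pos r hr).le hw.le]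
    have := (Real.rpow_pos_of_pos hw (p + 1)).ne'
    rw [hNdef]
    field_simp
  have hfac : ∀ r ∈ Ioo a b, 0 < (p + 3) / (2 * (p + 1)) * r ^ (-p) := fun r hr =>
    mul_pos (by positivity) (Real.rpow_pos_of_pos (ha.trans hr.1) _)
  have hratio : ∀ r ∈ Ioo a b, 0 < w₂ r / w₁ r := fun r hr => div_pos (h₂.pos r hr) (h₁.pos r hr)
  have hp1 : 0 < p + 1 := by linarith
  have hZmono : MonotoneOn Z (Icc a s) := by
    refine monotoneOn_Icc_of_hasDerivAt (hZc.mono (Icc_subset_Icc_right hs.2))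
      (fun r hr => hZd r ⟨hr.1, hr.2.trans_le hs.2⟩) fun r hr => ?_
    have hrb : r ∈ Ioo a b := ⟨hr.1, hr.2.trans_le hs.2⟩
    have hrm : r ∈ Ioc a s ∩ Iio b := ⟨Ioo_subset_Ioc_self hr, hrb.2⟩
    have hwp : 0 ≤ w₁ r ^ (p + 1) := Real.rpow_nonneg (h₁.pos r hrb).le _
    refine mul_nonneg (hfac r hrb).le ?_
    rcases le_total r c with h | h
    · refine mul_nonneg (hNpos r ⟨hr.1.le, h⟩) (mul_nonneg hwp (sub_nonneg.2 ?_))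
      exact Real.rpow_le_rpow (hratio r hrb).le
        (hmono.monotoneOn hrm hxmem (le_min h hr.2.le)) hp1.le
    · refine mul_nonneg_of_nonpos_of_nonpos (hNneg r ⟨h, hrb.2.le⟩)
        (mul_nonpos_of_nonneg_of_nonpos hwp (sub_nonpos.2 ?_))
      exact Real.rpow_le_rpow (hratio x ⟨hax, hxb⟩).le
        (hmono.monotoneOn hxmem hrm ((min_le_left _ _).trans h)) hp1.le
  -- Near a both N and σ - (w₂/w₁)^(p+1) are strictly positive, which makes Z(s) > 0 strict.
  set e := min y x with he
  have hae : a < e := lt_min hy.1 hax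
  have hex : e ≤ x := min_le_right _ _
  have hZstrict : StrictMonoOn Z (Icc a e) := by
    refine strictMonoOn_Icc_of_hasDerivAt
      (hZc.mono (Icc_subset_Icc_right (hex.trans hxb.le)))
      (fun r hr => hZd r ⟨hr.1, hr.2.trans_le (hex.trans hxb.le)⟩) fun r hr => ?_
    have hrx : r < x := hr.2.trans_le hex
    have hrb : r ∈ Ioo a b := ⟨hr.1, hrx.trans hxb⟩
    refine mul_pos (hfac r hrb) (mul_pos (hyN r ⟨hr.1.le, hr.2.le.trans (min_le_left _ _)⟩)
      (mul_pos (Real.rpow_pos_of_pos (h₁.pos r hrb) _) (sub_pos.2 ?_)))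
    exact Real.rpow_lt_rpow (hratio r hrb).le
      (hmono ⟨⟨hr.1, (hrx.trans_le hxs).le⟩, hrb.2⟩ hxmem hrx) hp1
  have hZs : 0 < Z s := by
    rw [← hZa]
    exact (hZstrict (left_mem_Icc.2 hae.le) (right_mem_Icc.2 hae.le) hae).trans_le
      (hZmono ⟨hae.le, hex.trans hxs⟩ (right_mem_Icc.2 hs.1.le) (hex.trans hxs))
  rcases hs.2.eq_or_lt with hsb | hsb
  · simp [hZ, hsb, h₁.pohozaev_right, h₂.pohozaev_right] at hZs
  have hsI : s ∈ Ioo a b := ⟨hs.1, hsb⟩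
  have hsI' := Ioo_subset_Icc_self hsI
  have hw1 := h₁.pos s hsI
  have hw2 := h₂.pos s hsI
  set ρ := w₂ s / w₁ s with hρ
  have hρ1 : 1 ≤ ρ := (one_le_div hw1).2 (hle hsb)
  have e2 : w₂ s = ρ * w₁ s := by rw [hρ]; field_simp
  have ed : d₂ s = ρ * d₁ s := by
    rw [hρ]
    field_simp
    linarith
  -- At s the pair (w₂, d₂) is ρ times (w₁, d₁). The quadratic part of J, which is nonpositive,
  -- scales by ρ², the rest by ρ^(p+1) ≥ ρ². Hence J₂ ≥ ρ^(p+1)J₁ ≥ σJ₁ at s, against Z(s) > 0.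
  have hT := mul_nonpos_of_nonpos_of_nonneg (h₁.wronskian_left_nonpos hk ha hπ hsI')
    (h₁.wronskian_right_nonneg hk ha hπ hsI')
  have hJpos := h₁.pohozaev_nonneg ha hp0 hc hNpos hNneg hsI'
  have hσρ : σ ≤ ρ ^ (p + 1) := Real.rpow_le_rpow (hratio x ⟨hax, hxb⟩).le
    (hmono.monotoneOn hxmem ⟨right_mem_Ioc.2 hs.1, hsb⟩ hxs) hp1.le
  have hρ2 : ρ ^ 2 ≤ ρ ^ (p + 1) := by
    rw [← Real.rpow_natCast]
    exact Real.rpow_le_rpow_of_exponent_le hρ1 (by push_cast; linarith)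
  have hJ2 : ρ ^ (p + 1) * pohozaev k p a b w₁ d₁ s ≤ pohozaev k p a b w₂ d₂ s := by
    have hwp : w₂ s ^ (p + 1) = ρ ^ (p + 1) * w₁ s ^ (p + 1) := by
      rw [e2, Real.mul_rpow (by linarith) hw1.le]
    simp only [pohozaev]
    rw [hwp, e2, ed]
    have := mul_nonneg_of_nonpos_of_nonpos (sub_nonpos.2 hρ2) hT
    generalize ρ ^ (p + 1) = τ at this ⊢
    generalize w₁ s ^ (p + 1) = ω at this ⊢
    rw [← sub_nonneg] at this ⊢
    refine (mul_nonneg (by norm_num : (0 : ℝ) ≤ 1 / 2) this).trans_eq ?_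
    ring
  have := mul_le_mul_of_nonneg_right hσρ hJpos
  simp only [hZ] at hZs
  linarith

/-- Reduced solutions with the same slope at `a` agree. -/
theorem eqOn_of_slope_eq (h₁ : IsReducedSolution k p a b w₁ d₁)
    (h₂ : IsReducedSolution k p a b w₂ d₂) (ha : 0 < a) (hp : 1 ≤ p)
    (hslope : d₂ a = d₁ a) : EqOn w₂ w₁ (Icc a b) := by
  obtain ⟨M₁, hM₁⟩ := isCompact_Icc.bddAbove_image h₁.continuousOn_fst
  obtain ⟨M₂, hM₂⟩ := isCompact_Icc.bddAbove_image h₂.continuousOn_fst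
  set M := max M₁ M₂
  set K := k ^ 2 + a ^ (1 - p) * (p * M ^ (p - 1)) with hK
  have hd : ∀ x ∈ Ico a b, HasDerivWithinAt (fun r => (w₂ r - w₁ r, d₂ r - d₁ r))
      (d₂ x - d₁ x, -(k ^ 2 * w₂ x + x ^ (1 - p) * w₂ x ^ p) -
        -(k ^ 2 * w₁ x + x ^ (1 - p) * w₁ x ^ p)) (Ici x) x := fun x hx => by
    have hx' := Ico_subset_Icc_self hx
    have h : HasDerivWithinAt (fun r => (w₂ r - w₁ r, d₂ r - d₁ r))
      (d₂ x - d₁ x, -(k ^ 2 * w₂ x + x ^ (1 - p) * w₂ x ^ p) -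
        -(k ^ 2 * w₁ x + x ^ (1 - p) * w₁ x ^ p)) (Icc a b) x :=
      ((h₂.hasDerivWithinAt_fst x hx').sub (h₁.hasDerivWithinAt_fst x hx')).prodMk
        ((h₂.hasDerivWithinAt_snd x hx').sub (h₁.hasDerivWithinAt_snd x hx'))
    exact h.mono_of_mem_nhdsWithin (Icc_mem_nhdsGE_of_mem hx)
  have hw1 := h₁.continuousOn_fst
  have hd1 := h₁.continuousOn_snd
  have hw2 := h₂.continuousOn_fst
  have hd2 := h₂.continuousOn_snd
  -- Gronwall in the sup norm of ℝ × ℝ: the first component of the derivative is bounded with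
  -- constant 1, the second with the Lipschitz constant K.
  have hzero := eq_zero_of_abs_deriv_le_mul_abs_self_of_eq_zero_right (K := max 1 K)
    (f := fun r => (w₂ r - w₁ r, d₂ r - d₁ r)) (by fun_prop) hd
    (by simp [h₁.left_boundary, h₂.left_boundary, hslope]) fun x hx => by
      have hx' := Ico_subset_Icc_self hx
      have hbd := abs_nonlinearity_sub_le (k := k) (M := M) ha hp hx.1
        (y := w₂ x) (z := w₁ x)
        ⟨h₂.nonneg hx', (hM₂ (mem_image_of_mem _ hx')).trans (le_max_right _ _)⟩
        ⟨h₁.nonneg hx', (hM₁ (mem_image_of_mem _ hx')).trans (le_max_left _ _)⟩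
      simp only [Prod.norm_def, Real.norm_eq_abs]
      refine max_le ?_ ?_
      · calc |d₂ x - d₁ x| = 1 * |d₂ x - d₁ x| := (one_mul _).symm
          _ ≤ max 1 K * max |w₂ x - w₁ x| |d₂ x - d₁ x| :=
            mul_le_mul (le_max_left _ _) (le_max_right _ _) (abs_nonneg _) (by positivity)
      · rw [neg_sub_neg, abs_sub_comm]
        exact hbd.trans (mul_le_mul (le_max_right _ _) (le_max_left _ _) (abs_nonneg _)
          (by positivity))
  intro x hx
  have := congrArg Prod.fst (hzero x hx)
  exact sub_eq_zero.1 this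

theorem eqOn (h₁ : IsReducedSolution k p a b w₁ d₁)
    (h₂ : IsReducedSolution k p a b w₂ d₂) (hk : 0 < k) (ha : 0 < a) (hab : a < b) (hp : 1 < p)
    (hπ : k * (b - a) < Real.pi)
    (hN : ∃ c ∈ Ioo a b, (∀ r ∈ Icc a c, 0 ≤ pohozaevSign k ((p - 5) / (p + 3)) a b r) ∧
      ∀ r ∈ Icc c b, pohozaevSign k ((p - 5) / (p + 3)) a b r ≤ 0) :
    EqOn w₂ w₁ (Icc a b) :=
  h₁.eqOn_of_slope_eq h₂ ha hp.le (le_antisymm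
    (not_lt.1 (h₂.not_slope_lt h₁ hk ha hab hp hπ hN))
    (not_lt.1 (h₁.not_slope_lt h₂ hk ha hab hp hπ hN)))

end IsReducedSolution

/-! ### Passage between the radial problem and the reduced problem -/

/-- If `w` is continuous on `[a, b]` and twice differentiable inside with `w'' = g` for a function
`g` continuous on `[a, b]`, then the derivatives extend to the closed interval. -/
theorem exists_hasDerivWithinAt_Icc_of_Ioo {a b : ℝ} (hab : a < b) {w e g : ℝ → ℝ}
    (hw : ContinuousOn w (Icc a b)) (hg : ContinuousOn g (Icc a b))
    (hwd : ∀ r ∈ Ioo a b, HasDerivAt w (e r) r) (hed : ∀ r ∈ Ioo a b, HasDerivAt e (g r) r) :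
    ∃ d : ℝ → ℝ, (∀ r ∈ Icc a b, HasDerivWithinAt w (d r) (Icc a b) r) ∧
      ∀ r ∈ Icc a b, HasDerivWithinAt d (g r) (Icc a b) r := by
  set m := (a + b) / 2 with hm
  have hmI : m ∈ Ioo a b := ⟨by linarith, by linarith⟩
  -- Extend g continuously to the line and integrate twice from the midpoint. The result is
  -- differentiable everywhere, agrees with w inside, and by continuity on [a, b].
  set G : ℝ → ℝ := IccExtend hab.le ((Icc a b).domRestrict g) with hG
  have hGc : Continuous G := (continuousOn_iff_continuous_domRestrict.1 hg).Icc_extend'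
  have hGg : ∀ r ∈ Icc a b, G r = g r := fun r hr => IccExtend_of_mem _ _ hr
  set d : ℝ → ℝ := fun r => e m + ∫ t in m..r, G t with hd
  have hdd : ∀ r, HasDerivAt d (G r) r := fun r => (hGc.integral_hasStrictDerivAt m r).hasDerivAt.const_add _
  have hdc : Continuous d := continuous_iff_continuousAt.2 fun r => (hdd r).continuousAt
  have hde : EqOn d e (Ioo a b) := by
    refine isOpen_Ioo.eqOn_of_deriv_eq isPreconnected_Ioo
      (fun r _ => (hdd r).differentiableAt.differentiableWithinAt)
      (fun r hr => (hed r hr).differentiableAt.differentiableWithinAt) (fun r hr => ?_) hmI ?_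
    · rw [(hdd r).deriv, (hed r hr).deriv, hGg r (Ioo_subset_Icc_self hr)]
    · simp [hd]
  set W : ℝ → ℝ := fun r => w m + ∫ t in m..r, d t with hW
  have hWd : ∀ r, HasDerivAt W (d r) r := fun r =>
    (hdc.integral_hasStrictDerivAt m r).hasDerivAt.const_add _
  have hWw : EqOn w W (Ioo a b) := by
    refine isOpen_Ioo.eqOn_of_deriv_eq isPreconnected_Ioo
      (fun r hr => (hwd r hr).differentiableAt.differentiableWithinAt)
      (fun r _ => (hWd r).differentiableAt.differentiableWithinAt) (fun r hr => ?_) hmI ?_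
    · rw [(hWd r).deriv, (hwd r hr).deriv, hde hr]
    · simp [hW]
  have hWw' : EqOn w W (Icc a b) := hWw.of_subset_closure hw
    (fun r _ => (hWd r).continuousAt.continuousWithinAt) Ioo_subset_Icc_self
    (closure_Ioo hab.ne).ge
  refine ⟨d, fun r hr => ((hWd r).hasDerivWithinAt).congr hWw' (hWw' hr), fun r hr => ?_⟩
  rw [← hGg r hr]
  exact (hdd r).hasDerivWithinAt

theorem continuousOn_nonlinearity {k p a b : ℝ} (ha : 0 < a) (hp : 0 ≤ p) {w : ℝ → ℝ}
    (hw : ContinuousOn w (Icc a b)) :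
    ContinuousOn (fun r => -(k ^ 2 * w r + r ^ (1 - p) * w r ^ p)) (Icc a b) := by
  have h1 : ContinuousOn (fun r : ℝ => r ^ (1 - p)) (Icc a b) := fun r hr =>
    (Real.continuousAt_rpow_const _ _ (Or.inl (ha.trans_le hr.1).ne')).continuousWithinAt
  have h2 : ContinuousOn (fun r => w r ^ p) (Icc a b) := hw.rpow_const fun _ _ => Or.inr hp
  fun_prop

/-- The substitution `w = r u` for `N = 3`. -/
theorem IsPositiveSolution.exists_isReducedSolution {k p a b : ℝ} {u : ℝ → ℝ}
    (h : IsPositiveSolution 3 (k ^ 2) p a b u) (ha : 0 < a) (hab : a < b) (hp : 0 ≤ p) :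
    ∃ d, IsReducedSolution k p a b (fun r => r * u r) d := by
  have hw : ContinuousOn (fun r => r * u r) (Icc a b) := continuousOn_id.mul h.continuousOn
  have hu : ∀ r ∈ Ioo a b, HasDerivAt u (deriv u r) r := fun r hr =>
    ((h.contDiffOn.differentiableOn (by norm_num)).differentiableAt
      (isOpen_Ioo.mem_nhds hr)).hasDerivAt
  have hu' : ∀ r ∈ Ioo a b, HasDerivAt (deriv u) (deriv (deriv u) r) r := fun r hr => by
    have h2 : ContDiffOn ℝ (1 + 1) u (Ioo a b) := by simpa [one_add_one_eq_two] using h.contDiffOn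
    exact ((((contDiffOn_succ_iff_deriv_of_isOpen isOpen_Ioo).1 h2).2.2.differentiableOn
      (by norm_num)).differentiableAt (isOpen_Ioo.mem_nhds hr)).hasDerivAt
  obtain ⟨d, hd1, hd2⟩ := exists_hasDerivWithinAt_Icc_of_Ioo hab hw
    (continuousOn_nonlinearity (k := k) ha hp hw)
    (e := fun r => u r + r * deriv u r)
    (fun r hr => ((hasDerivAt_id r).mul (hu r hr)).congr_deriv (by simp))
    (fun r hr => by
      refine ((hu r hr).add ((hasDerivAt_id r).mul (hu' r hr))).congr_deriv ?_
      have hr0 : 0 < r := ha.trans hr.1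
      have heq := h.equation r hr
      have hpow : r ^ (1 - p) * (r * u r) ^ p = r * u r ^ p := by
        rw [Real.mul_rpow hr0.le (h.pos r hr).le, ← mul_assoc, ← Real.rpow_add hr0]
        simp
      simp only [id, hpow]
      push_cast at heq
      field_simp at heq
      linarith)
  exact ⟨d, hd1, hd2, by simp [h.left_boundary], by simp [h.right_boundary],
    fun r hr => mul_pos (ha.trans hr.1) (h.pos r hr)⟩

theorem IsReducedSolution.isPositiveSolution {k p a b : ℝ} {w d : ℝ → ℝ}
    (h : IsReducedSolution k p a b w d) (ha : 0 < a) (hp : 0 ≤ p) :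
    IsPositiveSolution 3 (k ^ 2) p a b (fun r => w r / r) := by
  set u : ℝ → ℝ := fun r => w r / r
  set f : ℝ → ℝ := fun r => -(k ^ 2 * w r + r ^ (1 - p) * w r ^ p) with hf
  have hu : ∀ r ∈ Ioo a b, HasDerivAt u ((d r * r - w r * 1) / r ^ 2) r := fun r hr =>
    (h.hasDerivAt_fst hr).fun_div (hasDerivAt_id r) (ha.trans hr.1).ne'
  have hderiv : ∀ r ∈ Ioo a b, deriv u =ᶠ[nhds r] fun r => (d r * r - w r * 1) / r ^ 2 :=
    fun r hr => Filter.eventually_of_mem (isOpen_Ioo.mem_nhds hr) fun x hx => (hu x hx).deriv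
  have hu' : ∀ r ∈ Ioo a b, HasDerivAt (deriv u) (f r / r - 2 * d r / r ^ 2 + 2 * w r / r ^ 3) r :=
    fun r hr => by
      have hr0 := (ha.trans hr.1).ne'
      refine HasDerivAt.congr_of_eventuallyEq ?_ (hderiv r hr)
      refine ((((h.hasDerivAt_snd hr).mul (hasDerivAt_id r)).sub
        ((h.hasDerivAt_fst hr).mul_const 1)).fun_div (hasDerivAt_pow 2 r)
        (pow_ne_zero 2 hr0)).congr_deriv ?_
      simp only [hf, id, Pi.sub_apply, Pi.mul_apply]
      field_simp
      push_cast
      ring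
  have hne : ∀ r ∈ Icc a b, r ≠ 0 := fun r hr => (ha.trans_le hr.1).ne'
  refine ⟨h.continuousOn_fst.div continuousOn_id hne, ?_, fun r hr => ?_,
    by simp [u, h.left_boundary], by simp [u, h.right_boundary],
    fun r hr => div_pos (h.pos r hr) (ha.trans hr.1)⟩
  · rw [← one_add_one_eq_two, contDiffOn_succ_iff_deriv_of_isOpen isOpen_Ioo]
    refine ⟨fun r hr => (hu r hr).differentiableAt.differentiableWithinAt, by simp, ?_⟩
    rw [show (1 : WithTop ℕ∞) = 0 + 1 by simp, contDiffOn_succ_iff_deriv_of_isOpen isOpen_Ioo]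
    refine ⟨fun r hr => (hu' r hr).differentiableAt.differentiableWithinAt, by simp, ?_⟩
    rw [contDiffOn_zero]
    have hc : ContinuousOn (fun r => f r / r - 2 * d r / r ^ 2 + 2 * w r / r ^ 3) (Icc a b) := by
      have h1 := continuousOn_nonlinearity (k := k) ha hp h.continuousOn_fst
      have h2 := h.continuousOn_snd
      have h3 := h.continuousOn_fst
      refine ((h1.div continuousOn_id hne).sub ((h2.const_mul 2).div (by fun_prop) fun r hr =>
        pow_ne_zero 2 (hne r hr))).add ((h3.const_mul 2).div (by fun_prop) fun r hr =>
        pow_ne_zero 3 (hne r hr))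
    exact (hc.mono Ioo_subset_Icc_self).congr fun r hr => (hu' r hr).deriv
  · have hr0 : 0 < r := ha.trans hr.1
    rw [(hu' r hr).deriv, (hu r hr).deriv]
    simp only [u, hf]
    rw [Real.div_rpow (h.pos r hr).le hr0.le, Real.rpow_sub hr0, Real.rpow_one]
    have := (Real.rpow_pos_of_pos hr0 p).ne'
    push_cast
    field_simp
    ring

/-! ### Existence by shooting -/

/-- `w`, with derivative `d`, solves the initial value problem `w a = 0`, `w' a = α` on `[a, b]`
for the equation `w'' + k ^ 2 * w⁺ + r ^ (1 - p) * (w⁺) ^ p = 0`. -/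
structure IsShot (k p a b α : ℝ) (w d : ℝ → ℝ) : Prop where
  hasDerivWithinAt_fst : ∀ r ∈ Icc a b, HasDerivWithinAt w (d r) (Icc a b) r
  hasDerivWithinAt_snd : ∀ r ∈ Icc a b,
    HasDerivWithinAt d (-(k ^ 2 * max (w r) 0 + r ^ (1 - p) * max (w r) 0 ^ p)) (Icc a b) r
  initial_value : w a = 0
  initial_slope : d a = α

theorem nonlinearity_nonneg {k p t y : ℝ} (ht : 0 ≤ t) (hy : 0 ≤ y) :
    0 ≤ k ^ 2 * y + t ^ (1 - p) * y ^ p := by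
  have := Real.rpow_nonneg ht (1 - p)
  have := Real.rpow_nonneg hy p
  positivity

theorem nonlinearity_le {k p a t y M : ℝ} (ha : 0 < a) (hp : 1 ≤ p) (ht : a ≤ t) (hy : 0 ≤ y)
    (hyM : y ≤ M) : k ^ 2 * y + t ^ (1 - p) * y ^ p ≤ k ^ 2 * M + a ^ (1 - p) * M ^ p := by
  have h1 : t ^ (1 - p) ≤ a ^ (1 - p) := Real.rpow_le_rpow_of_nonpos ha ht (by linarith)
  have h2 : y ^ p ≤ M ^ p := Real.rpow_le_rpow hy hyM (by linarith)
  have h3 : 0 ≤ a ^ (1 - p) := Real.rpow_nonneg ha.le _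
  have h4 : 0 ≤ y ^ p := Real.rpow_nonneg hy p
  gcongr

/-- Solutions of the initial value problems with slopes in `[0, A]` exist and depend continuously
on the slope. -/
theorem exists_isShot_family {k p a b A : ℝ} (ha : 0 < a) (hab : a < b) (hp : 1 ≤ p)
    (hA : 0 ≤ A) :
    ∃ w d : ℝ → ℝ → ℝ, (∀ α ∈ Icc 0 A, IsShot k p a b α (w α) (d α)) ∧
      ContinuousOn (fun α => w α b) (Icc 0 A) := by
  have hba : 0 < b - a := sub_pos.2 hab
  set M := A * (b - a) with hM
  have hM0 : 0 ≤ M := mul_nonneg hA hba.le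
  set G := k ^ 2 * M + a ^ (1 - p) * M ^ p with hG
  have hG0 : 0 ≤ G := nonlinearity_nonneg ha.le hM0
  set L := A + G * (b - a) with hL
  have hL0 : 0 ≤ L := by positivity
  set K := k ^ 2 + a ^ (1 - p) * (p * M ^ (p - 1)) with hK
  have hK0 : 0 ≤ K := by
    have := Real.rpow_nonneg ha.le (1 - p)
    have := Real.rpow_nonneg hM0 (p - 1)
    positivity
  -- Clamping both components makes the field globally Lipschitz and bounded by L + G, so
  -- Picard–Lindelöf applies on all of [a, b] at once, with one Lipschitz constant for all slopes.
  -- The a priori bounds below, -G(b-a) ≤ d ≤ A and w ≤ M, show that the clamp on d and the upper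
  -- clamp on w are inactive.
  set f : ℝ → ℝ × ℝ → ℝ × ℝ := fun t y => (max (-L) (min y.2 L),
    -(k ^ 2 * max 0 (min y.1 M) + t ^ (1 - p) * max 0 (min y.1 M) ^ p)) with hf
  have hclamp : ∀ y : ℝ, max 0 (min y M) ∈ Icc 0 M := fun y =>
    ⟨le_max_left _ _, max_le hM0 (min_le_right _ _)⟩
  have hclip : ∀ c e y z : ℝ, |max c (min y e) - max c (min z e)| ≤ |y - z| := fun c e y z =>
    (abs_max_sub_max_le_max _ _ _ _).trans (by
      simpa using abs_min_sub_min_le_max y e z e)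
  have hPL : IsPicardLindelof f (tmin := a) (tmax := b) ⟨a, left_mem_Icc.2 hab.le⟩ (0 : ℝ × ℝ)
      (A + (L + G) * (b - a)).toNNReal A.toNNReal (L + G).toNNReal (max 1 K).toNNReal := by
    refine ⟨fun t ht => ?_, fun x _ => ?_, fun t ht x _ => ?_, ?_⟩
    · refine (LipschitzWith.of_dist_le_mul fun y z => ?_).lipschitzOnWith
      rw [Real.coe_toNNReal _ (by positivity)]
      simp only [hf, Prod.dist_eq, Real.dist_eq]
      refine max_le ?_ ?_
      · calc _ ≤ 1 * |y.2 - z.2| := by rw [one_mul]; exact hclip _ _ _ _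
          _ ≤ _ := mul_le_mul (le_max_left _ _) (le_max_right _ _) (abs_nonneg _) (by positivity)
      · rw [neg_sub_neg, abs_sub_comm]
        refine (abs_nonlinearity_sub_le ha hp ht.1 (hclamp y.1) (hclamp z.1)).trans ?_
        exact mul_le_mul (le_max_right _ _) ((hclip _ _ _ _).trans (le_max_left _ _))
          (abs_nonneg _) (by positivity)
    · have h1 : ContinuousOn (fun r : ℝ => r ^ (1 - p)) (Icc a b) := fun r hr =>
        (Real.continuousAt_rpow_const _ _ (Or.inl (ha.trans_le hr.1).ne')).continuousWithinAt
      simp only [hf]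
      fun_prop
    · rw [Real.coe_toNNReal _ (by positivity)]
      simp only [hf, Prod.norm_def, Real.norm_eq_abs]
      refine max_le ?_ ?_
      · rw [abs_le]
        have h1 : -L ≤ max (-L) (min x.2 L) := le_max_left _ _
        have h2 : max (-L) (min x.2 L) ≤ L := max_le (by linarith) (min_le_right _ _)
        exact ⟨by linarith, by linarith⟩
      · rw [abs_neg, abs_of_nonneg (nonlinearity_nonneg (ha.le.trans ht.1) (hclamp x.1).1)]
        have := nonlinearity_le (k := k) ha hp ht.1 (hclamp x.1).1 (hclamp x.1).2
        linarith
    · rw [Real.coe_toNNReal _ (by positivity), Real.coe_toNNReal _ (by positivity),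
        Real.coe_toNNReal _ hA]
      simp [hba.le]
  obtain ⟨φ, hφ, L', hLip⟩ := hPL.exists_forall_mem_closedBall_eq_hasDerivWithinAt_lipschitzOnWith
  rw [Real.coe_toNNReal _ hA] at hφ hLip
  have hmem : ∀ α ∈ Icc 0 A, ((0, α) : ℝ × ℝ) ∈ Metric.closedBall (0 : ℝ × ℝ) A := fun α hα => by
    simp [Prod.norm_def, abs_of_nonneg hα.1, hα.2, hA]
  refine ⟨fun α t => (φ (0, α) t).1, fun α t => (φ (0, α) t).2, fun α hα => ?_, ?_⟩
  · obtain ⟨hinit, hder⟩ := hφ _ (hmem α hα)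
    set w : ℝ → ℝ := fun t => (φ (0, α) t).1 with hw
    set d : ℝ → ℝ := fun t => (φ (0, α) t).2 with hd
    have hw0 : w a = 0 := by simp [hw, hinit]
    have hd0 : d a = α := by simp [hd, hinit]
    have hwd : ∀ t ∈ Icc a b, HasDerivWithinAt w (max (-L) (min (d t) L)) (Icc a b) t :=
      fun t ht => (ContinuousLinearMap.fst ℝ ℝ ℝ).hasFDerivAt.comp_hasDerivWithinAt t (hder t ht)
    have hdd : ∀ t ∈ Icc a b, HasDerivWithinAt d
        (-(k ^ 2 * max 0 (min (w t) M) + t ^ (1 - p) * max 0 (min (w t) M) ^ p)) (Icc a b) t :=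
      fun t ht => (ContinuousLinearMap.snd ℝ ℝ ℝ).hasFDerivAt.comp_hasDerivWithinAt t (hder t ht)
    have hwc : ContinuousOn w (Icc a b) := fun t ht => (hwd t ht).continuousWithinAt
    have hdc : ContinuousOn d (Icc a b) := fun t ht => (hdd t ht).continuousWithinAt
    have haI : a ∈ Icc a b := left_mem_Icc.2 hab.le
    have hdle : ∀ t ∈ Icc a b, d t ≤ α := fun t ht => by
      rw [← hd0]
      refine antitoneOn_Icc_of_hasDerivAt hdc (fun x hx => (hdd x (Ioo_subset_Icc_self hx)).hasDerivAt
        (Icc_mem_nhds hx.1 hx.2)) (fun x hx => ?_) haI ht ht.1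
      exact neg_nonpos.2 (nonlinearity_nonneg (ha.trans hx.1).le (hclamp _).1)
    have hdge : ∀ t ∈ Icc a b, α - G * (t - a) ≤ d t := fun t ht => by
      have := monotoneOn_Icc_of_hasDerivAt (f := fun t => d t + G * t) (by fun_prop)
        (fun x hx => ((hdd x (Ioo_subset_Icc_self hx)).hasDerivAt
          (Icc_mem_nhds hx.1 hx.2)).add ((hasDerivAt_id x).const_mul G)) (fun x hx => by
          have := nonlinearity_le (k := k) ha hp hx.1.le (hclamp (w x)).1 (hclamp (w x)).2
          linarith) haI ht ht.1
      simp only [hd0] at this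
      linarith
    have hdL : ∀ t ∈ Icc a b, max (-L) (min (d t) L) = d t := fun t ht => by
      have h1 := hdle t ht
      have h2 := hdge t ht
      have h3 : G * (t - a) ≤ G * (b - a) := by
        gcongr
        exact ht.2
      have h4 : 0 ≤ G * (b - a) := by positivity
      rw [min_eq_left (by linarith [hα.2]), max_eq_right (by linarith [hα.1])]
    have hwM : ∀ t ∈ Icc a b, w t ≤ M := fun t ht => by
      have := antitoneOn_Icc_of_hasDerivAt (f := fun t => w t - A * t) (by fun_prop)
        (fun x hx => ((hwd x (Ioo_subset_Icc_self hx)).hasDerivAt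
          (Icc_mem_nhds hx.1 hx.2)).sub ((hasDerivAt_id x).const_mul A)) (fun x hx => by
          have hx' := Ioo_subset_Icc_self hx
          rw [hdL x hx']
          linarith [hdle x hx', hα.2]) haI ht ht.1
      simp only [hw0] at this
      have h3 : A * (t - a) ≤ A * (b - a) := by
        gcongr
        exact ht.2
      linarith
    refine ⟨fun t ht => ?_, fun t ht => ?_, hw0, hd0⟩
    · have := hwd t ht
      rwa [hdL t ht] at this
    · have := hdd t ht
      rwa [min_eq_left (hwM t ht), max_comm] at this
  · have h1 := (hLip b (right_mem_Icc.2 hab.le)).continuousOn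
    have h2 : ContinuousOn (fun α : ℝ => ((0, α) : ℝ × ℝ)) (Icc 0 A) := by fun_prop
    exact continuous_fst.comp_continuousOn (h1.comp h2 hmem)

namespace IsShot

variable {k p a b α : ℝ} {w d : ℝ → ℝ}

theorem continuousOn_fst (h : IsShot k p a b α w d) : ContinuousOn w (Icc a b) :=
  fun r hr => (h.hasDerivWithinAt_fst r hr).continuousWithinAt

theorem continuousOn_snd (h : IsShot k p a b α w d) : ContinuousOn d (Icc a b) :=
  fun r hr => (h.hasDerivWithinAt_snd r hr).continuousWithinAt

theorem hasDerivAt_fst (h : IsShot k p a b α w d) {r : ℝ} (hr : r ∈ Ioo a b) :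
    HasDerivAt w (d r) r :=
  (h.hasDerivWithinAt_fst r (Ioo_subset_Icc_self hr)).hasDerivAt (Icc_mem_nhds hr.1 hr.2)

theorem hasDerivAt_snd (h : IsShot k p a b α w d) {r : ℝ} (hr : r ∈ Ioo a b) :
    HasDerivAt d (-(k ^ 2 * max (w r) 0 + r ^ (1 - p) * max (w r) 0 ^ p)) r :=
  (h.hasDerivWithinAt_snd r (Ioo_subset_Icc_self hr)).hasDerivAt (Icc_mem_nhds hr.1 hr.2)

theorem antitoneOn_snd (h : IsShot k p a b α w d) (ha : 0 < a) : AntitoneOn d (Icc a b) :=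
  antitoneOn_Icc_of_hasDerivAt h.continuousOn_snd (fun _ hx => h.hasDerivAt_snd hx) fun _ hx =>
    neg_nonpos.2 (nonlinearity_nonneg (ha.trans hx.1).le (le_max_right _ _))

theorem concaveOn (h : IsShot k p a b α w d) (ha : 0 < a) : ConcaveOn ℝ (Icc a b) w :=
  concaveOn_Icc_of_hasDerivAt h.continuousOn_fst (fun _ hx => h.hasDerivAt_fst hx)
    (fun _ hx => h.hasDerivAt_snd hx) fun _ hx =>
      neg_nonpos.2 (nonlinearity_nonneg (ha.trans hx.1).le (le_max_right _ _))

theorem le_slope_mul (h : IsShot k p a b α w d) (ha : 0 < a) {r : ℝ} (hr : r ∈ Icc a b) :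
    w r ≤ α * (r - a) := by
  have hw := h.continuousOn_fst
  have haI : a ∈ Icc a b := left_mem_Icc.2 (hr.1.trans hr.2)
  have := antitoneOn_Icc_of_hasDerivAt (f := fun t => w t - α * t) (by fun_prop)
    (fun x hx => (h.hasDerivAt_fst hx).sub ((hasDerivAt_id x).const_mul α)) (fun x hx => by
      have := h.antitoneOn_snd ha haI (Ioo_subset_Icc_self hx) hx.1.le
      rw [h.initial_slope] at this
      linarith) haI hr hr.1
  simp only [h.initial_value] at this
  linarith

theorem exists_pos (h : IsShot k p a b α w d) (hab : a < b) (hα : 0 < α) :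
    ∃ x ∈ Ioo a b, ∀ r ∈ Ioc a x, 0 < w r := by
  obtain ⟨x, hx, hxd⟩ := exists_forall_pos_of_continuousOn hab h.continuousOn_snd
    (h.initial_slope.symm ▸ hα)
  refine ⟨x, hx, fun r hr => ?_⟩
  have := strictMonoOn_Icc_of_hasDerivAt (h.continuousOn_fst.mono (Icc_subset_Icc_right hx.2.le))
    (fun y hy => h.hasDerivAt_fst ⟨hy.1, hy.2.trans hx.2⟩)
    (fun y hy => hxd y (Ioo_subset_Icc_self hy)) (left_mem_Icc.2 hx.1.le)
    (Ioc_subset_Icc_self hr) hr.1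
  rwa [h.initial_value] at this

/-- A shot is positive before every point at which it is nonnegative. -/
theorem pos_of_nonneg (h : IsShot k p a b α w d) (ha : 0 < a) (hα : 0 < α) {z : ℝ}
    (hz : z ∈ Ioc a b) (hwz : 0 ≤ w z) {r : ℝ} (hr : r ∈ Ioo a z) : 0 < w r := by
  obtain ⟨x, hx, hxw⟩ := h.exists_pos (hz.1.trans_le hz.2) hα
  by_contra hn
  push Not at hn
  set y := min x ((a + r) / 2)
  have hya : a < y := lt_min hx.1 (by linarith [hr.1])
  have hyr : y < r := (min_le_right _ _).trans_lt (by linarith [hr.1])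
  have hy := hxw y ⟨hya, min_le_left _ _⟩
  -- A concave function that falls from a positive value to a nonpositive one cannot return to a
  -- nonnegative value.
  have hs := (h.concaveOn ha).slope_anti_adjacent ⟨hya.le, (hyr.trans hr.2).le.trans hz.2⟩
    (Ioc_subset_Icc_self hz) hyr hr.2
  have h1 : 0 ≤ (w z - w r) / (z - r) := div_nonneg (by linarith) (by linarith [hr.2])
  have h2 : (w r - w y) / (r - y) < 0 := div_neg_of_neg_of_pos (by linarith) (by linarith)
  linarith

/-- Since d decreases, d z ≥ 0 would make w increasing on [a, z], so w could not be positive inside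
and vanish at z. -/
theorem snd_neg_of_zero (h : IsShot k p a b α w d) (ha : 0 < a) (hα : 0 < α) {z : ℝ}
    (hz : z ∈ Ioc a b) (hwz : w z = 0) : d z < 0 := by
  by_contra hn
  push Not at hn
  have hmono := monotoneOn_Icc_of_hasDerivAt (a := a) (b := z)
    (h.continuousOn_fst.mono (Icc_subset_Icc_right hz.2))
    (fun y hy => h.hasDerivAt_fst ⟨hy.1, hy.2.trans_le hz.2⟩) fun y hy => hn.trans
      (h.antitoneOn_snd ha ⟨hy.1.le, hy.2.le.trans hz.2⟩ (Ioc_subset_Icc_self hz) hy.2.le)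
  have hm : (a + z) / 2 ∈ Ioo a z := ⟨by linarith [hz.1], by linarith [hz.1]⟩
  have h1 := hmono (Ioo_subset_Icc_self hm) (right_mem_Icc.2 hz.1.le) hm.2.le
  have h2 := h.pos_of_nonneg ha hα hz hwz.ge hm
  linarith

theorem isReducedSolution (h : IsShot k p a b α w d) (ha : 0 < a) (hab : a < b) (hα : 0 < α)
    (hwb : w b = 0) : IsReducedSolution k p a b w d := by
  have hpos : ∀ r ∈ Ioo a b, 0 < w r := fun r hr =>
    h.pos_of_nonneg ha hα (right_mem_Ioc.2 hab) hwb.ge hr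
  refine ⟨h.hasDerivWithinAt_fst, fun r hr => ?_, h.initial_value, hwb, hpos⟩
  have hnn : 0 ≤ w r := by
    rcases hr.1.eq_or_lt with rfl | h1
    · exact h.initial_value.ge
    rcases hr.2.eq_or_lt with rfl | h2
    · exact hwb.ge
    exact (hpos r ⟨h1, h2⟩).le
  have := h.hasDerivWithinAt_snd r hr
  rwa [max_eq_left hnn] at this

/-- The Wronskian of a shot with a sine, where the shot is positive. -/
theorem hasDerivAt_wronskian_sin (h : IsShot k p a b α w d) (hp : 0 < p) (κ c : ℝ)
    {r : ℝ} (hr : r ∈ Ioo a b) (hw : 0 < w r) :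
    HasDerivAt (fun r => Real.sin (κ * (r - c)) * d r - κ * Real.cos (κ * (r - c)) * w r)
      (Real.sin (κ * (r - c)) * w r * (κ ^ 2 - k ^ 2 - r ^ (1 - p) * w r ^ (p - 1))) r := by
  refine (((hasDerivAt_sin_mul_sub κ c r).mul (h.hasDerivAt_snd hr)).sub
    (((hasDerivAt_cos_mul_sub κ c r).const_mul κ).mul (h.hasDerivAt_fst hr))).congr_deriv ?_
  have : w r ^ p = w r * w r ^ (p - 1) := by
    rw [← Real.rpow_one_add' hw.le (by linarith)]
    ring_nf
  rw [max_eq_left hw.le, this]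
  ring

/-- Shots with small slope are positive at `b`. -/
theorem pos_right_of_small (h : IsShot k p a b α w d) (ha : 0 < a) (hab : a < b) (hp : 1 < p)
    (hα : 0 < α) {κ : ℝ} (hκ : 0 < κ) (hκπ : κ * (b - a) < Real.pi)
    (hsmall : a ^ (1 - p) * (α * (b - a)) ^ (p - 1) ≤ κ ^ 2 - k ^ 2) : 0 < w b := by
  by_contra hn
  push Not at hn
  have hw := h.continuousOn_fst
  have hd := h.continuousOn_snd
  obtain ⟨x, hx, hxw⟩ := h.exists_pos hab hα
  obtain ⟨z, hz, hwz⟩ := intermediate_value_Icc' hx.2.le (hw.mono (Icc_subset_Icc_left hx.1.le))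
    ⟨hn, (hxw x (right_mem_Ioc.2 hx.1)).le⟩
  have hzI : z ∈ Ioc a b := ⟨hx.1.trans_le hz.1, hz.2⟩
  have hsin : ∀ r ∈ Ioc a b, 0 < Real.sin (κ * (r - a)) := fun r hr =>
    Real.sin_pos_of_pos_of_lt_pi (mul_pos hκ (sub_pos.2 hr.1))
      ((mul_le_mul_of_nonneg_left (by linarith [hr.2]) hκ.le).trans_lt hκπ)
  -- Sturm comparison: the bound w ≤ α(b-a) keeps k² + r^(1-p)w^(p-1) at most κ², so this Wronskian
  -- increases from 0. At a zero z of w it would equal sin κ(z-a) d(z) < 0.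
  have hmono := monotoneOn_Icc_of_hasDerivAt (a := a) (b := z)
    (f := fun r => Real.sin (κ * (r - a)) * d r - κ * Real.cos (κ * (r - a)) * w r)
    (ContinuousOn.mono (by fun_prop) (Icc_subset_Icc_right hz.2))
    (fun r hr => h.hasDerivAt_wronskian_sin (by linarith) κ a ⟨hr.1, hr.2.trans_le hz.2⟩
      (h.pos_of_nonneg ha hα hzI hwz.ge hr)) (fun r hr => by
      have hrI : r ∈ Ioc a b := ⟨hr.1, hr.2.le.trans hz.2⟩
      have hwr := h.pos_of_nonneg ha hα hzI hwz.ge hr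
      refine mul_nonneg (mul_pos (hsin r hrI) hwr).le ?_
      have h1 : w r ≤ α * (b - a) := (h.le_slope_mul ha (Ioc_subset_Icc_self hrI)).trans
        (mul_le_mul_of_nonneg_left (by linarith [hrI.2]) hα.le)
      have h2 : r ^ (1 - p) ≤ a ^ (1 - p) :=
        Real.rpow_le_rpow_of_nonpos ha hr.1.le (by linarith)
      have h3 : w r ^ (p - 1) ≤ (α * (b - a)) ^ (p - 1) :=
        Real.rpow_le_rpow hwr.le h1 (by linarith)
      have := mul_le_mul h2 h3 (Real.rpow_nonneg hwr.le _) (Real.rpow_nonneg ha.le _)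
      linarith)
    (left_mem_Icc.2 hzI.1.le) (right_mem_Icc.2 hzI.1.le) hzI.1.le
  simp only [h.initial_value, hwz, sub_self, mul_zero, Real.sin_zero, zero_mul, sub_zero] at hmono
  exact absurd (mul_neg_of_pos_of_neg (hsin z hzI) (h.snd_neg_of_zero ha hα hzI hwz))
    (not_lt.2 hmono)

end IsShot

/-- A nonnegative concave function on `[a, b]` is bounded by three times each of its values on the
middle third. -/
theorem ConcaveOn.le_three_mul {a b : ℝ} {f : ℝ → ℝ} (hf : ConcaveOn ℝ (Icc a b) f)
    (hnn : ∀ r ∈ Icc a b, 0 ≤ f r) {r t : ℝ} (hr1 : a + (b - a) / 3 ≤ r)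
    (hr2 : r ≤ b - (b - a) / 3) (ht : t ∈ Icc a b) : f t ≤ 3 * f r := by
  have hab : a ≤ b := ht.1.trans ht.2
  have hr : r ∈ Icc a b := ⟨by linarith, by linarith⟩
  have ha := hnn a (left_mem_Icc.2 hab)
  have hb := hnn b (right_mem_Icc.2 hab)
  have hr0 := hnn r hr
  by_contra hn
  push Not at hn
  rcases lt_trichotomy t r with h | h | h
  · have hrb : r < b := by linarith [ht.1]
    -- Here r-t ≤ 2(b-a)/3 and b-r ≥ (b-a)/3, so a drop by more than 2f(r) from t to r would force
    -- f(b) < 0.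
    have hs := hf.slope_anti_adjacent ht (right_mem_Icc.2 hab) h hrb
    rw [div_le_div_iff₀ (by linarith) (by linarith)] at hs
    nlinarith [ht.1]
  · rw [h] at hn
    linarith
  · have har : a < r := by linarith [ht.2]
    have hs := hf.slope_anti_adjacent (left_mem_Icc.2 hab) ht har h
    rw [div_le_div_iff₀ (by linarith) (by linarith)] at hs
    nlinarith [ht.2]

namespace IsShot

variable {k p a b α : ℝ} {w d : ℝ → ℝ}

/-- Shots with large slope are nonpositive at `b`. -/
theorem exists_forall_nonpos_right (k : ℝ) (ha : 0 < a) (hab : a < b) (hp : 1 < p) :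
    ∃ A > 0, ∀ α ≥ A, ∀ w d : ℝ → ℝ, IsShot k p a b α w d → w b ≤ 0 := by
  have hba : 0 < b - a := sub_pos.2 hab
  have hb : 0 < b := ha.trans hab
  set δ := (b - a) / 3 with hδ
  have hδ0 : 0 < δ := by positivity
  set Ω := Real.pi / δ with hΩ
  have hΩ0 : 0 < Ω := div_pos Real.pi_pos hδ0
  -- A bound for w independent of α, valid if w(b) > 0: somewhere in the middle third (w/r)^(p-1) <
  -- Ω², and concavity costs the factor 3.
  set S := 3 * (b * (Ω ^ 2) ^ (1 / (p - 1))) with hS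
  have hS0 : 0 < S := by positivity
  set G := k ^ 2 * S + a ^ (1 - p) * S ^ p with hG
  have hG0 : 0 ≤ G := nonlinearity_nonneg ha.le hS0.le
  refine ⟨G * (b - a) + (S + 1) / (b - a), by positivity, fun α hα w d h => ?_⟩
  have hα0 : 0 < α := lt_of_lt_of_le (by positivity) hα
  by_contra hn
  push Not at hn
  have hw := h.continuousOn_fst
  have hd := h.continuousOn_snd
  have hpos : ∀ r ∈ Ioc a b, 0 < w r := fun r hr => by
    rcases hr.2.eq_or_lt with rfl | h2
    · exact hn
    · exact h.pos_of_nonneg ha hα0 (right_mem_Ioc.2 hab) hn.le ⟨hr.1, h2⟩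
  have hnn : ∀ r ∈ Icc a b, 0 ≤ w r := fun r hr => by
    rcases hr.1.eq_or_lt with rfl | h1
    · exact h.initial_value.ge
    · exact (hpos r ⟨h1, hr.2⟩).le
  -- by comparison with a sine, `w` is not large on the whole middle third
  obtain ⟨r, hr, hrS⟩ : ∃ r ∈ Ioo (a + δ) (b - δ), r ^ (1 - p) * w r ^ (p - 1) < Ω ^ 2 := by
    by_contra hcon
    push Not at hcon
    have hsub : Icc (a + δ) (b - δ) ⊆ Icc a b := Icc_subset_Icc (by linarith) (by linarith)
    have hle : a + δ ≤ b - δ := by linarith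
    have hlen : b - δ - (a + δ) = δ := by rw [hδ]; ring
    -- Comparison with sin Ω(r-a-δ), whose half-period is exactly δ: this Wronskian is -Ωw(a+δ) < 0
    -- at the left end and Ωw(b-δ) > 0 at the right end, so it cannot decrease.
    have hanti := antitoneOn_Icc_of_hasDerivAt (a := a + δ) (b := b - δ)
      (f := fun r => Real.sin (Ω * (r - (a + δ))) * d r
        - Ω * Real.cos (Ω * (r - (a + δ))) * w r)
      (ContinuousOn.mono (by fun_prop) hsub)
      (fun r hr => h.hasDerivAt_wronskian_sin (by linarith) Ω (a + δ)
        ⟨by linarith [hr.1], by linarith [hr.2]⟩ (hpos r ⟨by linarith [hr.1], by linarith [hr.2]⟩))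
      (fun r hr => by
        refine mul_nonpos_of_nonneg_of_nonpos (mul_nonneg
          (Real.sin_nonneg_of_nonneg_of_le_pi (mul_nonneg hΩ0.le (by linarith [hr.1])) ?_)
          (hnn r ⟨by linarith [hr.1], by linarith [hr.2]⟩)) ?_
        · calc Ω * (r - (a + δ)) ≤ Ω * δ := by
                refine mul_le_mul_of_nonneg_left ?_ hΩ0.le
                linarith [hr.2]
            _ = Real.pi := by rw [hΩ]; field_simp
        · have := hcon r hr
          linarith [sq_nonneg k])
      (left_mem_Icc.2 hle) (right_mem_Icc.2 hle) hle
    have hΩδ : Ω * δ = Real.pi := by rw [hΩ]; field_simp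
    simp only [hlen, hΩδ, sub_self, mul_zero, Real.sin_zero, Real.cos_zero, Real.sin_pi,
      Real.cos_pi] at hanti
    have h1 := mul_pos hΩ0 (hpos (a + δ) ⟨by linarith, by linarith⟩)
    have h2 := mul_pos hΩ0 (hpos (b - δ) ⟨by linarith, by linarith⟩)
    linarith
  have hr0 : 0 < r := by linarith [hr.1]
  have hrI : r ∈ Ioc a b := ⟨by linarith [hr.1], by linarith [hr.2]⟩
  have hwr : 3 * w r ≤ S := by
    have h1 : (w r / r) ^ (p - 1) < Ω ^ 2 := by
      rw [Real.div_rpow (hpos r hrI).le hr0.le, div_eq_mul_inv, ← Real.rpow_neg hr0.le, mul_comm,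
        neg_sub]
      exact hrS
    have h2 : w r / r < (Ω ^ 2) ^ (1 / (p - 1)) := by
      have h3 := Real.rpow_lt_rpow (Real.rpow_nonneg (div_pos (hpos r hrI) hr0).le _) h1
        (one_div_pos.2 (sub_pos.2 hp))
      rwa [one_div, Real.rpow_rpow_inv (div_pos (hpos r hrI) hr0).le (sub_pos.2 hp).ne',
        ← one_div] at h3
    rw [div_lt_iff₀ hr0] at h2
    have h4 : (Ω ^ 2) ^ (1 / (p - 1)) * r ≤ (Ω ^ 2) ^ (1 / (p - 1)) * b :=
      mul_le_mul_of_nonneg_left hrI.2 (by positivity)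
    linarith
  have hwS : ∀ t ∈ Icc a b, w t ≤ S := fun t ht =>
    ((h.concaveOn ha).le_three_mul hnn hr.1.le hr.2.le ht).trans hwr
  have haI : a ∈ Icc a b := left_mem_Icc.2 hab.le
  have hbI : b ∈ Icc a b := right_mem_Icc.2 hab.le
  -- The slope loses at most G(b-a) along the way; what remains would lift w(b) to at least S + 1,
  -- above the bound S.
  have hdge : ∀ t ∈ Icc a b, (S + 1) / (b - a) ≤ d t := fun t ht => by
    have := monotoneOn_Icc_of_hasDerivAt (f := fun t => d t + G * t) (by fun_prop)
      (fun x hx => (h.hasDerivAt_snd hx).add ((hasDerivAt_id x).const_mul G)) (fun x hx => by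
        have := nonlinearity_le (k := k) ha hp.le hx.1.le (le_max_right (w x) 0)
          (max_le (hwS x (Ioo_subset_Icc_self hx)) hS0.le)
        linarith) haI ht ht.1
    simp only [h.initial_slope] at this
    have h3 : G * (t - a) ≤ G * (b - a) := mul_le_mul_of_nonneg_left (by linarith [ht.2]) hG0
    linarith
  have hlin := monotoneOn_Icc_of_hasDerivAt (f := fun t => w t - (S + 1) / (b - a) * t)
    (by fun_prop) (fun x hx => (h.hasDerivAt_fst hx).sub ((hasDerivAt_id x).const_mul _))
    (fun x hx => by linarith [hdge x (Ioo_subset_Icc_self hx)]) haI hbI hab.le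
  simp only [h.initial_value] at hlin
  have h5 : (S + 1) / (b - a) * (b - a) = S + 1 := by field_simp
  linarith [hwS b hbI]

end IsShot

/-- The reduced problem has a solution whenever `b - a < π / k`. -/
theorem exists_isReducedSolution {k p a b : ℝ} (hk : 0 < k) (ha : 0 < a) (hab : a < b)
    (hp : 1 < p) (hπ : k * (b - a) < Real.pi) : ∃ w d, IsReducedSolution k p a b w d := by
  have hba : 0 < b - a := sub_pos.2 hab
  obtain ⟨A, hA, hlarge⟩ := IsShot.exists_forall_nonpos_right (p := p) k ha hab hp
  -- Any κ strictly between k and π/(b-a) would serve.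
  set κ := (k + Real.pi / (b - a)) / 2 with hκ
  have hkπ : k < Real.pi / (b - a) := (lt_div_iff₀ hba).2 hπ
  have hkκ : k < κ := by linarith
  have hκπ : κ * (b - a) < Real.pi := by
    rw [← lt_div_iff₀ hba]
    linarith
  have hε : 0 < κ ^ 2 - k ^ 2 := sub_pos.2 (pow_lt_pow_left₀ hkκ hk.le two_ne_zero)
  set T := ((κ ^ 2 - k ^ 2) / a ^ (1 - p)) ^ (p - 1)⁻¹ with hT
  have ha' : 0 < a ^ (1 - p) := Real.rpow_pos_of_pos ha _
  have hT0 : 0 < T := Real.rpow_pos_of_pos (div_pos hε ha') _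
  set α₀ := min (T / (b - a)) A with hα₀
  have hα₀pos : 0 < α₀ := lt_min (div_pos hT0 hba) hA
  have hsmall : a ^ (1 - p) * (α₀ * (b - a)) ^ (p - 1) ≤ κ ^ 2 - k ^ 2 := by
    have h1 : α₀ * (b - a) ≤ T := (le_div_iff₀ hba).1 (min_le_left _ _)
    have h2 := Real.rpow_le_rpow (mul_pos hα₀pos hba).le h1 (sub_pos.2 hp).le
    rw [hT, Real.rpow_inv_rpow (div_pos hε ha').le (sub_pos.2 hp).ne', le_div_iff₀ ha'] at h2
    linarith
  obtain ⟨w, d, hshot, hcont⟩ := exists_isShot_family (k := k) ha hab hp.le hA.le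
  have h1 := (hshot α₀ ⟨hα₀pos.le, min_le_right _ _⟩).pos_right_of_small ha hab hp hα₀pos
    (hk.trans hkκ) hκπ hsmall
  have h2 := hlarge A le_rfl _ _ (hshot A (right_mem_Icc.2 hA.le))
  obtain ⟨α, hα, hαb⟩ := intermediate_value_Icc' (min_le_right _ _ : α₀ ≤ A)
    (hcont.mono (Icc_subset_Icc_left hα₀pos.le)) ⟨h2, h1.le⟩
  exact ⟨w α, d α, (hshot α ⟨hα₀pos.le.trans hα.1, hα.2⟩).isReducedSolution ha hab
    (hα₀pos.trans_le hα.1) hαb⟩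

/-! ### The threshold radius and the three cases -/

/-- This identifies r₀ as the turning radius of `weightWronskian`, where 4k²r² = q(1-q). -/
theorem four_mul_thresholdRadius_sq {lam p : ℝ} (hlam : 0 < lam) (hp : 5 < p) :
    4 * lam * thresholdRadius 3 lam p ^ 2 = (p - 5) / (p + 3) * (1 - (p - 5) / (p + 3)) := by
  have h1 : 0 < p - 1 := by linarith
  have h3 : 0 < p + 3 := by linarith
  have h5 : 0 < p - 5 := by linarith
  have e : (2 * ((((3 : ℕ) : ℝ) - 2) * p + ((3 : ℕ) : ℝ) - 4) *
      ((((3 : ℕ) : ℝ) - 2) * p - (((3 : ℕ) : ℝ) + 2)) / (lam * (p - 1) * (p + 3) ^ 2)) =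
      2 * (p - 5) / (lam * (p + 3) ^ 2) := by
    push_cast
    field_simp
    ring
  rw [thresholdRadius, e, Real.sq_sqrt (by positivity)]
  field_simp
  ring

/-- The threshold radius in terms of `√((p - 5) / (p + 3))`. -/
theorem two_mul_sqrt_mul_thresholdRadius {lam p : ℝ} (hlam : 0 < lam) (hp : 5 < p) :
    2 * Real.sqrt lam * thresholdRadius 3 lam p =
      Real.sqrt ((p - 5) / (p + 3)) * Real.sqrt (1 - Real.sqrt ((p - 5) / (p + 3)) ^ 2) := by
  have h3 : 0 < p + 3 := by linarith
  have h5 : 0 < p - 5 := by linarith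
  have hq0 : 0 ≤ (p - 5) / (p + 3) := by positivity
  have hq1 : 0 ≤ 1 - (p - 5) / (p + 3) := by
    rw [sub_nonneg, div_le_one h3]
    linarith
  have hr : 0 ≤ thresholdRadius 3 lam p := Real.sqrt_nonneg _
  rw [Real.sq_sqrt hq0]
  refine (pow_left_inj₀ (by positivity) (by positivity)
    two_ne_zero).1 ?_
  rw [mul_pow, mul_pow, mul_pow, Real.sq_sqrt hlam.le, Real.sq_sqrt hq0, Real.sq_sqrt hq1,
    ← four_mul_thresholdRadius_sq hlam hp]
  norm_num

theorem two_mul_sqrt_div_eq {lam p : ℝ} (hlam : 0 < lam) (hp : 5 < p) :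
    2 * Real.sqrt (2 * (p - 5)) / (p + 3) = 2 * (Real.sqrt lam * thresholdRadius 3 lam p) := by
  have h3 : 0 < p + 3 := by linarith
  have h5 : 0 < p - 5 := by linarith
  have hr : 0 ≤ thresholdRadius 3 lam p := Real.sqrt_nonneg _
  refine (pow_left_inj₀ (by positivity) (by positivity) two_ne_zero).1 ?_
  rw [div_pow, mul_pow, mul_pow, mul_pow, Real.sq_sqrt (by positivity), Real.sq_sqrt hlam.le]
  have := four_mul_thresholdRadius_sq hlam hp
  rw [show (2 : ℝ) ^ 2 * (lam * thresholdRadius 3 lam p ^ 2) =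
    4 * lam * thresholdRadius 3 lam p ^ 2 by ring, this]
  field_simp
  ring

/-- This supplies k(b-a) < π in case (iii), where it is not assumed. -/
theorem mul_sqrt_one_sub_sq_le_arccos {s : ℝ} (hs1 : s ≤ 1) :
    s * Real.sqrt (1 - s ^ 2) ≤ Real.arccos s := by
  rw [← Real.sin_arccos]
  calc s * Real.sin (Real.arccos s) ≤ 1 * Real.sin (Real.arccos s) :=
        mul_le_mul_of_nonneg_right hs1 (Real.sin_arccos s ▸ Real.sqrt_nonneg _)
    _ ≤ Real.arccos s := by
        rw [one_mul]
        exact Real.sin_le (Real.arccos_nonneg s)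

/-- Existence and uniqueness, given that `pohozaevSign` changes sign exactly once. -/
theorem hasUniquePositiveSolution_of_pohozaevSign {k p a b : ℝ} (hk : 0 < k) (ha : 0 < a)
    (hab : a < b) (hp : 1 < p) (hπ : k * (b - a) < Real.pi)
    (hN : ∃ c ∈ Ioo a b, (∀ r ∈ Icc a c, 0 ≤ pohozaevSign k ((p - 5) / (p + 3)) a b r) ∧
      ∀ r ∈ Icc c b, pohozaevSign k ((p - 5) / (p + 3)) a b r ≤ 0) :
    HasUniquePositiveSolution 3 (k ^ 2) p a b := by
  obtain ⟨w, d, hwd⟩ := exists_isReducedSolution hk ha hab hp hπ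
  refine ⟨fun r => w r / r, hwd.isPositiveSolution ha (by linarith), fun v hv r hr => ?_⟩
  obtain ⟨e, he⟩ := hv.exists_isReducedSolution ha hab (by linarith)
  have := hwd.eqOn he hk ha hab hp hπ hN hr
  exact (eq_div_iff (ha.trans_le hr.1).ne').2 (by rw [← this, mul_comm])

/-- `weightWronskian` is nonnegative at `a` if `a + π / k - arctan (2 k a / q) / k ≤ b`. -/
theorem weightWronskian_left_nonneg {k q a b : ℝ} (hk : 0 < k) (ha : 0 < a) (hq : 0 < q)
    (hπ : k * (b - a) < Real.pi)
    (hb : Real.pi - Real.arctan (2 * k * a / q) ≤ k * (b - a)) :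
    0 ≤ weightWronskian k q a b a := by
  set τ := Real.pi - k * (b - a) with hτ
  have hτ0 : 0 < τ := sub_pos.2 hπ
  have hτ1 : τ ≤ Real.arctan (2 * k * a / q) := by linarith
  have hτ2 : τ < Real.pi / 2 := hτ1.trans_lt (Real.arctan_lt_pi_div_two _)
  have hcos : 0 < Real.cos τ := Real.cos_pos_of_mem_Ioo ⟨by linarith, hτ2⟩
  have htan : Real.tan τ ≤ 2 * k * a / q := by
    rw [← Real.tan_arctan (2 * k * a / q)]
    exact Real.strictMonoOn_tan.monotoneOn ⟨by linarith, hτ2⟩ (Real.arctan_mem_Ioo _) hτ1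
  rw [Real.tan_eq_sin_div_cos, div_le_div_iff₀ hcos hq] at htan
  refine mul_nonneg (Real.rpow_nonneg ha.le _) ?_
  -- In terms of τ the claim reads q sin τ ≤ 2ka cos τ, which is the tangent bound above.
  rw [sineWeightDeriv, show k * (a + b - 2 * a) = Real.pi - τ by rw [hτ]; ring, Real.cos_pi_sub,
    Real.sin_pi_sub]
  have := mul_nonneg hk.le (sub_nonneg.2 htan)
  linarith

/-- `weightWronskian` is nonpositive at the turning radius `ρ` if `k (a + b - 2 ρ)` is at most
`arccos (-√q)`. -/
theorem weightWronskian_nonpos_of_le_arccos {k a b ρ s : ℝ} (hk : 0 < k)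
    (hs0 : 0 ≤ s) (hs1 : s ≤ 1) (hρ : 2 * k * ρ = s * Real.sqrt (1 - s ^ 2)) (hρ0 : 0 ≤ ρ)
    (hρM : ρ ≤ (a + b) / 2) (hb : k * (a + b - 2 * ρ) ≤ Real.arccos (-s)) :
    weightWronskian k (s ^ 2) a b ρ ≤ 0 := by
  set X := k * (a + b - 2 * ρ) with hX
  have hX0 : 0 ≤ X := mul_nonneg hk.le (by linarith)
  have hsin : 0 ≤ Real.sin (Real.arccos (-s) - X) :=
    Real.sin_nonneg_of_nonneg_of_le_pi (by linarith) (by linarith [Real.arccos_le_pi (-s)])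
  -- By 2kρ = s√(1-s²), the second factor of the Wronskian at ρ is -ks(√(1-s²) cos X + s sin X) =
  -- -ks sin(arccos(-s) - X).
  rw [Real.sin_sub, Real.sin_arccos, Real.cos_arccos (by linarith) (by linarith), neg_sq] at hsin
  refine mul_nonpos_of_nonneg_of_nonpos (Real.rpow_nonneg hρ0 _) ?_
  rw [sineWeightDeriv, ← hX]
  have h1 : ρ * -(2 * k ^ 2 * Real.cos X) = -(k * (2 * k * ρ) * Real.cos X) := by ring
  rw [h1, hρ]
  have := mul_nonneg (mul_nonneg hk.le hs0) hsin
  linarith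

theorem theorem1p2 (lam p a b : ℝ) (hlam : 0 < lam) (hp : 5 < p) (ha : 0 < a) (hab : a < b)
    (hcases :
      -- case (i)
      ((thresholdRadius 3 lam p ≤ a ∨ b ≤ thresholdRadius 3 lam p) ∧
        b < a + Real.pi / Real.sqrt lam) ∨
      -- case (ii)
      (a < thresholdRadius 3 lam p ∧ thresholdRadius 3 lam p < b ∧
        a + Real.pi / Real.sqrt lam
          - 1 / Real.sqrt lam * Real.arctan (2 * (p + 3) * Real.sqrt lam / (p - 5) * a) ≤ b ∧
        b < a + Real.pi / Real.sqrt lam) ∨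
      -- case (iii)
      (a < thresholdRadius 3 lam p ∧ thresholdRadius 3 lam p < b ∧
        b ≤ -a + 1 / Real.sqrt lam *
          (2 * Real.sqrt (2 * (p - 5)) / (p + 3)
            + Real.arccos (-Real.sqrt ((p - 5) / (p + 3)))))) :
    HasUniquePositiveSolution 3 lam p a b := by
  have h3 : 0 < p + 3 := by linarith
  have h5 : 0 < p - 5 := by linarith
  have hq : 0 < (p - 5) / (p + 3) := by positivity
  have hq1 : (p - 5) / (p + 3) ≤ 1 := (div_le_one h3).2 (by linarith)
  have hk : 0 < Real.sqrt lam := Real.sqrt_pos.2 hlam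
  have hk2 : Real.sqrt lam ^ 2 = lam := Real.sq_sqrt hlam.le
  have hρ0 : 0 ≤ thresholdRadius 3 lam p := Real.sqrt_nonneg _
  have hρ1 := two_mul_sqrt_div_eq hlam hp
  have hρ2 := two_mul_sqrt_mul_thresholdRadius hlam hp
  have hρ3 : 4 * Real.sqrt lam ^ 2 * thresholdRadius 3 lam p ^ 2 =
      (p - 5) / (p + 3) * (1 - (p - 5) / (p + 3)) := by
    rw [hk2, four_mul_thresholdRadius_sq hlam hp]
  set k := Real.sqrt lam with hkdef
  set ρ := thresholdRadius 3 lam p with hρ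
  have hs0 := Real.sqrt_nonneg ((p - 5) / (p + 3))
  have hs1 : Real.sqrt ((p - 5) / (p + 3)) ≤ 1 := Real.sqrt_le_one.2 hq1
  have hs2 : Real.sqrt ((p - 5) / (p + 3)) ^ 2 = (p - 5) / (p + 3) := Real.sq_sqrt hq.le
  set s := Real.sqrt ((p - 5) / (p + 3)) with hs
  have hlt : b < a + Real.pi / k → k * (b - a) < Real.pi := fun h => by
    rw [mul_comm, ← lt_div_iff₀ hk]
    linarith
  have hfin : k * (b - a) < Real.pi → _ → _ := fun hπ h =>
    hasUniquePositiveSolution_of_pohozaevSign hk ha hab (by linarith) hπ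
      (exists_pohozaevSign_change hk ha hab hπ hq hρ0 hρ3 h)
  rw [hk2] at hfin
  rcases hcases with ⟨h, hb⟩ | ⟨-, -, hb, hb'⟩ | ⟨haρ, -, hb⟩
  · exact hfin (hlt hb) (h.imp_right fun h => Or.inl (by linarith))
  · refine hfin (hlt hb') (Or.inr (Or.inr (Or.inl
      (weightWronskian_left_nonneg hk ha hq (hlt hb') ?_))))
    have e : 2 * k * a / ((p - 5) / (p + 3)) = 2 * (p + 3) * k / (p - 5) * a := by
      field_simp
    rw [e]
    have := mul_le_mul_of_nonneg_left hb hk.le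
    have e2 : ∀ x, k * (a + Real.pi / k - 1 / k * x) = k * a + Real.pi - x := fun x => by
      field_simp
    rw [e2] at this
    linarith
  · have hX : k * (a + b - 2 * ρ) ≤ Real.arccos (-s) := by
      have := mul_le_mul_of_nonneg_left hb hk.le
      have e2 : ∀ x, k * (-a + 1 / k * x) = -(k * a) + x := fun x => by
        field_simp
      rw [e2, hρ1] at this
      linarith
    -- Since arccos(-s) = π - arccos s and 2kρ = s√(1-s²) ≤ arccos s, `hX` gives k(a+b) ≤ π.
    have hπ : k * (b - a) < Real.pi := by
      have h1 := mul_sqrt_one_sub_sq_le_arccos hs1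
      rw [Real.arccos_neg] at hX
      have := mul_pos hk ha
      linarith
    refine hfin hπ ?_
    rcases le_total ((a + b) / 2) ρ with hM | hM
    · exact Or.inr (Or.inl hM)
    · refine Or.inr (Or.inr (Or.inr ?_))
      rw [← hs2]
      exact weightWronskian_nonpos_of_le_arccos hk hs0 hs1 hρ2 hρ0 hM hX
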